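/- Let $H\in(\frac12,1)$, $\beta\in(0,\frac14)$ and $p\in(\frac1\beta,\infty)$. Let $\phi_k(x)=\sqrt2\sin(k\pi x)$ and $\lambda_k=k^2\pi^2$ ($k\ge1$) be the eigenfunctions and eigenvalues of $A=-\frac{d^2}{dx^2}$ on $U=L^2(0,1)$ with homogeneous Dirichlet boundary conditions. Then there is a constant $C=C(p,\beta,H)>0$, depending only on $p$, $\beta$ and $H$, such that the following holds. Let $\eta\ge0$, $T>0$, and let $B^H(t)=\sum_{k\ge1}w^H_k(t)\phi_k$, $t\in[0,T]$, be a standard cylindrical fractional Brownian motion on a probability space $(\Omega,\mathcal F,\mathbb P)$, where $(w_k^H)_{k\ge1}$ are independent real standard fractional Brownian motions with Hurst parameter $H$, that is, centred Gaussian processes with (almost surely) continuous paths and covariance $\frac12(s^{2H}+t^{2H}-|t-s|^{2H})$. For every $t\in[0,T]$ the stochastic convolution $$\mathbb O^\eta_t:=\int_0^t e^{-(t-s)(A+\eta)}\,dB^H(s)=\sum_{k=1}^\infty\int_0^t e^{-(t-s)(A+\eta)}\phi_k\,dw^H_k(s)$$ exists. Here the series converges in $L^2(\Omega;U)$, and the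 integral of a deterministic function in $L^2(0,t;U)$ against $w_k^H$ is the $L^2(\Omega;U)$-limit of the integrals of step functions converging to it in $L^2(0,t;U)$. Moreover $$\left(\mathbb E\left[\|\mathbb O^\eta_t\|_{L^\infty(0,1)}^p\right]\right)^{1/p}\le C(p,\beta,H)\left(\sum_{k=1}^\infty\frac{k^{4\beta}}{(\lambda_k+\eta)^{2H}}\right)^{1/2},$$ where the series on the right-hand side converges. -/

import Mathlib

open MeasureTheory ProbabilityTheory Filter Topology Set
open scoped ENNReal

noncomputable section

/-! ### Fractional Brownian motion -/

/-- `w` is a standard real fractional Brownian motion with Hurst parameter `H` on `[0, T]`: a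
centred Gaussian process with almost surely continuous paths and covariance
`(s^(2H) + t^(2H) - |t - s|^(2H)) / 2`. Values of `w` at times outside `[0, T]` are irrelevant. -/
structure IsFBm {Ω : Type*} [MeasurableSpace Ω] (H T : ℝ) (w : ℝ → Ω → ℝ)
    (P : Measure Ω) : Prop where
  measurable : ∀ s ∈ Icc (0 : ℝ) T, Measurable (w s)
  gaussian : IsGaussianProcess (fun s : Icc (0 : ℝ) T => w s) P
  centered : ∀ s ∈ Icc (0 : ℝ) T, ∫ ω, w s ω ∂P = 0
  covariance_eq : ∀ s ∈ Icc (0 : ℝ) T, ∀ t ∈ Icc (0 : ℝ) T,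
    cov[w s, w t; P] = (s ^ (2 * H) + t ^ (2 * H) - |t - s| ^ (2 * H)) / 2
  continuous_paths : ∀ᵐ ω ∂P, ContinuousOn (fun s => w s ω) (Icc (0 : ℝ) T)

/-- The data of a standard cylindrical fractional Brownian motion on `[0, T]`: the coordinates
`w 0, w 1, …` are fractional Brownian motions with the same Hurst parameter, independent as
processes on `[0, T]`. -/
structure IsCylindricalFBm {Ω : Type*} [MeasurableSpace Ω] (H T : ℝ) (w : ℕ → ℝ → Ω → ℝ)
    (P : Measure Ω) : Prop where
  isFBm : ∀ k, IsFBm H T (w k) P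
  indep : iIndepFun (fun k ω => fun s : Icc (0 : ℝ) T => w k s ω) P

/-! ### Wiener integrals of deterministic vector-valued integrands -/

/-- A step function on `[0, t]` with values in `V`:
`∑ i < size, value i • 1_{(node i, node (i + 1)]}`, with increasing nodes in `[0, t]`. -/
structure StepFun (t : ℝ) (V : Type*) where
  size : ℕ
  node : ℕ → ℝ
  node_mono : Monotone node
  node_mem : ∀ i, node i ∈ Icc (0 : ℝ) t
  value : ℕ → V

/-- The function `[0, t] → V` given by a step function. -/
def StepFun.eval {t : ℝ} {V : Type*} [AddCommGroup V] (f : StepFun t V) (s : ℝ) : V :=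
  ∑ i ∈ Finset.range f.size, (Ioc (f.node i) (f.node (i + 1))).indicator (fun _ => f.value i) s

/-- The integral of a step function against a real process:
`∑ i < size, (w (node (i + 1)) - w (node i)) • value i`. -/
def StepFun.integral {t : ℝ} {V : Type*} [AddCommGroup V] [Module ℝ V] {Ω : Type*}
    (f : StepFun t V) (w : ℝ → Ω → ℝ) (ω : Ω) : V :=
  ∑ i ∈ Finset.range f.size, (w (f.node (i + 1)) ω - w (f.node i) ω) • f.value i

/-- `X = ∫₀ᵗ G(s) dw(s)`, for a deterministic `G : [0, t] → V`: `X` is the mean-square limit of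
the integrals of step functions converging to `G` in `L²(0, t; V)`. If `w` is a fractional
Brownian motion on an interval containing `[0, t]` with Hurst parameter in `(1/2, 1)`, such an `X` is unique up to almost sure
equality (for `V` a Hilbert space). -/
def IsWienerIntegral {Ω : Type*} [MeasurableSpace Ω] {V : Type*} [NormedAddCommGroup V]
    [NormedSpace ℝ V] (w : ℝ → Ω → ℝ) (t : ℝ) (G : ℝ → V) (X : Ω → V) (P : Measure Ω) : Prop :=
  AEStronglyMeasurable G (volume.restrict (Ioc 0 t)) ∧ AEStronglyMeasurable X P ∧
  ∃ f : ℕ → StepFun t V,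
    Tendsto (fun n => eLpNorm (fun s => G s - (f n).eval s) 2 (volume.restrict (Ioc 0 t)))
      atTop (𝓝 0) ∧
    Tendsto (fun n => eLpNorm (fun ω => X ω - (f n).integral w ω) 2 P) atTop (𝓝 0)

/-! ### The Dirichlet Laplacian on `(0, 1)` and its semigroup -/

/-- Lebesgue measure on the interval `(0, 1)`. -/
abbrev volD : Measure ℝ := volume.restrict (Ioo (0 : ℝ) 1)

/-- The Hilbert space `U = L²(0, 1)`. -/
abbrev U : Type := Lp ℝ 2 volD

lemma memLp_sine (k : ℕ) :
    MemLp (fun x : ℝ => Real.sqrt 2 * Real.sin ((k + 1) * Real.pi * x)) 2 volD := by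
  refine MemLp.of_bound (Continuous.aestronglyMeasurable (by fun_prop)) (Real.sqrt 2)
    (Eventually.of_forall fun x => ?_)
  rw [Real.norm_eq_abs, abs_mul, abs_of_nonneg (Real.sqrt_nonneg 2)]
  exact mul_le_of_le_one_right (Real.sqrt_nonneg 2) (Real.abs_sin_le_one _)

/-- The `(k + 1)`-st eigenfunction `x ↦ √2 sin((k + 1) π x)` of the Dirichlet Laplacian. These
functions form an orthonormal basis of `U`. -/
def eigenfun (k : ℕ) : U := (memLp_sine k).toLp _

/-- The `(k + 1)`-st eigenvalue `((k + 1) π)²` of `A = -d²/dx²` with Dirichlet conditions. -/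
def eigenval (k : ℕ) : ℝ := (((k : ℝ) + 1) * Real.pi) ^ 2

/-- The semigroup `S^η(r) = exp(-r (A + η))` generated by `-A - η` on `U`, by the spectral
representation `S^η(r) ψ = ∑ₖ exp(-r (λₖ + η)) ⟨φₖ, ψ⟩ φₖ`. -/
def shiftedSemigroup (η r : ℝ) (ψ : U) : U :=
  ∑' k : ℕ, (Real.exp (-(r * (eigenval k + η))) * inner ℝ (eigenfun k) ψ) • eigenfun k

/-! ### The stochastic convolution -/

/-- `O = ∫₀ᵗ g(s) dB(s)` for the cylindrical process `B = ∑ₖ wₖ φₖ` and a deterministic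
operator-valued `g`: `O` is the mean-square limit of the series `∑ₖ ∫₀ᵗ g(s) φₖ dwₖ(s)`. -/
def IsCylindricalIntegral {Ω : Type*} [MeasurableSpace Ω] (w : ℕ → ℝ → Ω → ℝ) (t : ℝ)
    (g : ℝ → U → U) (O : Ω → U) (P : Measure Ω) : Prop :=
  AEStronglyMeasurable O P ∧ ∃ I : ℕ → Ω → U,
    (∀ k, IsWienerIntegral (w k) t (fun s => g s (eigenfun k)) (I k) P) ∧
    Tendsto (fun n => eLpNorm (fun ω => O ω - ∑ k ∈ Finset.range n, I k ω) 2 P) atTop (𝓝 0)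

/-- `O` is the shifted stochastic convolution `∫₀ᵗ S^η(t - s) dB(s)` at time `t`. -/
def IsStochasticConvolution {Ω : Type*} [MeasurableSpace Ω] (w : ℕ → ℝ → Ω → ℝ) (η t : ℝ)
    (O : Ω → U) (P : Measure Ω) : Prop :=
  IsCylindricalIntegral w t (fun s => shiftedSemigroup η (t - s)) O P

end

/-!
The proof combines a variance bound for Wiener integrals, the equivalence of Gaussian moments, and
chaining in the space variable.

For `H > 1/2` the increments of a fractional Brownian motion over two intervals have covariance
`∬ H (2H - 1) |s - r|^(2H - 2) ds dr`. Hence the integral of a step function `f` with values in a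
Hilbert space satisfies `E ‖∫ f dw‖² = ∬ ⟨f s, f r⟩ H (2H - 1) |s - r|^(2H - 2) ds dr`
(`integral_norm_sq_sum_increment_smul`), which is at most a constant times `∫ ‖f‖²`. So the
mean-square limit in the definition of the Wiener integral exists and does not depend on the
approximating step functions (`exists_isWienerIntegral`, `IsWienerIntegral.tendsto_of_tendsto`).
One may therefore always approximate `exp(-μ (t - s))` from below, by its left endpoint values on
uniform grids; the variance of these integrals is at most `C μ^(-2H)`, uniformly in `t` and in the
grid (`IsFBm.lintegral_expStep_integral_le`). For `μ = λₖ + η` the square roots of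
these bounds are of order `k^(-2H)`, hence summable as `2H > 1`, and the series defining the
stochastic convolution converges absolutely in `L²(Ω; U)`.

For the moment bound, consider the random trigonometric polynomials `S(x) = ∑ Zₖ φₖ(x)`, where `Zₖ`
is the integral of the step approximation with `μ = λₖ + η`. The `Zₖ` are independent centred
Gaussians and `|φₖ(x) - φₖ(y)|² ≤ C k^(4β) |x - y|^(4β)`, so `S(x) - S(y)` is a centred Gaussian of
variance at most `C A |x - y|^(4β)` with `A = ∑ k^(4β) / (λₖ + η)^(2H)`, and its `p`-th moment is at
most `C A^(p/2) |x - y|^(2βp)`. As `S(0) = 0` and `2βp > 1`, chaining over dyadic points bounds the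
`p`-th moment of the supremum of `|S|` by `C A^(p/2)` (`exists_sup_bound_of_increments`). Such a
bound survives mean-square limits by Fatou's lemma (`SupMomentLE.of_tendsto`); it passes from the
polynomials `S` to the partial sums of the series, and from these to the stochastic convolution.
-/

/-! ### The kernel of the covariance -/

/-- The kernel `H (2H - 1) |u|^(2H - 2)`: the covariance of the increments of a fractional Brownian
motion over two intervals is the integral of `fbmKernel H (s - r)` over the product of the
intervals. -/
noncomputable def fbmKernel (H u : ℝ) : ℝ := H * (2 * H - 1) * |u| ^ (2 * H - 2)

/-- The primitive of `fbmKernel H` vanishing at `0`. -/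
noncomputable def fbmKernelPrimitive (H u : ℝ) : ℝ := H * |u| ^ (2 * H - 2) * u

lemma fbmKernel_nonneg {H : ℝ} (hH : 1 / 2 < H) (u : ℝ) : 0 ≤ fbmKernel H u :=
  mul_nonneg (mul_nonneg (by linarith) (by linarith)) (Real.rpow_nonneg (abs_nonneg _) _)

lemma fbmKernel_neg (H u : ℝ) : fbmKernel H (-u) = fbmKernel H u := by
  simp [fbmKernel]

@[fun_prop]
lemma measurable_fbmKernel (H : ℝ) : Measurable (fbmKernel H) := by
  unfold fbmKernel; fun_prop

lemma hasDerivAt_fbmKernelPrimitive (H : ℝ) {u : ℝ} (hu : u ≠ 0) :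
    HasDerivAt (fbmKernelPrimitive H) (fbmKernel H u) u := by
  have key : ∀ x : ℝ, 0 < x → HasDerivAt (fun y : ℝ => H * y ^ (2 * H - 1)) (fbmKernel H x) x := by
    intro x hx
    have h := (Real.hasDerivAt_rpow_const (p := 2 * H - 1) (Or.inl hx.ne')).const_mul H
    convert! h using 1
    rw [fbmKernel, abs_of_pos hx, show 2 * H - 1 - 1 = 2 * H - 2 by ring]
    ring
  have pow_eq : ∀ x : ℝ, 0 < x → x ^ (2 * H - 2) * x = x ^ (2 * H - 1) := by
    intro x hx
    rw [← Real.rpow_add_one hx.ne', show 2 * H - 2 + 1 = 2 * H - 1 by ring]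
  rcases lt_or_gt_of_ne hu with h | h
  · have h1 := (key (-u) (by linarith)).scomp u (hasDerivAt_neg u)
    have h2 := h1.neg
    simp only [fbmKernel_neg, smul_eq_mul, neg_mul, one_mul, neg_neg] at h2
    refine h2.congr_of_eventuallyEq ?_
    filter_upwards [Iio_mem_nhds h] with y hy
    have hy' : (0 : ℝ) < -y := by simpa using hy
    simp only [fbmKernelPrimitive, Pi.neg_apply, Function.comp_apply, ← pow_eq _ hy',
      abs_of_neg (mem_Iio.1 hy)]
    ring
  · refine (key u h).congr_of_eventuallyEq ?_
    filter_upwards [Ioi_mem_nhds h] with y hy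
    rw [← pow_eq _ hy, fbmKernelPrimitive, abs_of_pos hy]
    ring

lemma hasDerivAt_abs_rpow_div_two {H : ℝ} (hH : 1 / 2 < H) (u : ℝ) :
    HasDerivAt (fun x : ℝ => |x| ^ (2 * H) / 2) (fbmKernelPrimitive H u) u := by
  refine ((hasDerivAt_abs_rpow u (p := 2 * H) (by linarith)).div_const 2).congr_deriv ?_
  rw [fbmKernelPrimitive]
  ring

lemma continuous_fbmKernelPrimitive {H : ℝ} (hH : 1 / 2 < H) :
    Continuous (fbmKernelPrimitive H) := by
  have h : ContDiff ℝ 1 (fun x : ℝ => |x| ^ (2 * H) / 2) :=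
    (contDiff_norm_rpow (E := ℝ) (p := 2 * H) (by linarith)).div_const 2
  have h2 := h.continuous_deriv le_rfl
  rwa [show deriv (fun x : ℝ => |x| ^ (2 * H) / 2) = fbmKernelPrimitive H from
    funext fun u => (hasDerivAt_abs_rpow_div_two hH u).deriv] at h2

lemma intervalIntegrable_fbmKernel {H : ℝ} (hH : 1 / 2 < H) (a b : ℝ) :
    IntervalIntegrable (fbmKernel H) volume a b := by
  have pos : ∀ c : ℝ, 0 ≤ c → IntervalIntegrable (fbmKernel H) volume 0 c := by
    intro c hc
    have h := (intervalIntegral.intervalIntegrable_rpow' (a := 0) (b := c) (r := 2 * H - 2)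
      (by linarith)).const_mul (H * (2 * H - 1))
    refine h.congr fun x hx => ?_
    rw [uIoc_of_le hc] at hx
    rw [fbmKernel, abs_of_pos hx.1]
  have all : ∀ c : ℝ, IntervalIntegrable (fbmKernel H) volume 0 c := by
    intro c
    rcases le_total 0 c with hc | hc
    · exact pos c hc
    · have h := (pos (-c) (by linarith)).comp_mul_left (c := -1)
      simpa [fbmKernel_neg] using h
  exact (all a).symm.trans (all b)

lemma integral_fbmKernel {H : ℝ} (hH : 1 / 2 < H) (a b : ℝ) :
    ∫ u in a..b, fbmKernel H u = fbmKernelPrimitive H b - fbmKernelPrimitive H a :=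
  integral_eq_of_hasDerivAt_off_countable _ _ (countable_singleton (0 : ℝ))
    (continuous_fbmKernelPrimitive hH).continuousOn
    (fun _ hx => hasDerivAt_fbmKernelPrimitive H hx.2) (intervalIntegrable_fbmKernel hH a b)

lemma integral_fbmKernelPrimitive {H : ℝ} (hH : 1 / 2 < H) (a b : ℝ) :
    ∫ u in a..b, fbmKernelPrimitive H u = |b| ^ (2 * H) / 2 - |a| ^ (2 * H) / 2 :=
  intervalIntegral.integral_eq_sub_of_hasDerivAt
    (fun x _ => hasDerivAt_abs_rpow_div_two hH x)
    ((continuous_fbmKernelPrimitive hH).intervalIntegrable a b)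

lemma intervalIntegrable_fbmKernel_sub {H : ℝ} (hH : 1 / 2 < H) (s c d : ℝ) :
    IntervalIntegrable (fun r => fbmKernel H (s - r)) volume c d := by
  have h := (intervalIntegrable_fbmKernel hH (s - c) (s - d)).comp_sub_left s
  simpa using h

lemma integral_fbmKernel_sub {H : ℝ} (hH : 1 / 2 < H) (s c d : ℝ) :
    ∫ r in c..d, fbmKernel H (s - r) =
      fbmKernelPrimitive H (s - c) - fbmKernelPrimitive H (s - d) := by
  rw [intervalIntegral.integral_comp_sub_left (fun u => fbmKernel H u), integral_fbmKernel hH]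

lemma lintegral_fbmKernel_sub {H : ℝ} (hH : 1 / 2 < H) (s : ℝ) {c d : ℝ} (hcd : c ≤ d) :
    ∫⁻ r in Ioc c d, ENNReal.ofReal (fbmKernel H (s - r)) =
      ENNReal.ofReal (fbmKernelPrimitive H (s - c) - fbmKernelPrimitive H (s - d)) := by
  rw [← integral_fbmKernel_sub hH, intervalIntegral.integral_of_le hcd,
    ofReal_integral_eq_lintegral_ofReal]
  · exact (intervalIntegrable_iff_integrableOn_Ioc_of_le hcd).1
      (intervalIntegrable_fbmKernel_sub hH s c d)
  · exact Eventually.of_forall fun r => fbmKernel_nonneg hH _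

/-- The integral of the kernel over a rectangle is the covariance of two increments. -/
lemma integral_integral_fbmKernel {H : ℝ} (hH : 1 / 2 < H) (a b c d : ℝ) :
    ∫ s in a..b, (∫ r in c..d, fbmKernel H (s - r)) =
      (|b - c| ^ (2 * H) + |a - d| ^ (2 * H) - |a - c| ^ (2 * H) - |b - d| ^ (2 * H)) / 2 := by
  have i1 : ∀ c : ℝ, IntervalIntegrable (fun s => fbmKernelPrimitive H (s - c)) volume a b :=
    fun c => ((continuous_fbmKernelPrimitive hH).comp
      (continuous_id.sub continuous_const)).intervalIntegrable a b
  simp_rw [integral_fbmKernel_sub hH]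
  rw [intervalIntegral.integral_sub (i1 c) (i1 d),
    intervalIntegral.integral_comp_sub_right (fun u => fbmKernelPrimitive H u),
    intervalIntegral.integral_comp_sub_right (fun u => fbmKernelPrimitive H u),
    integral_fbmKernelPrimitive hH, integral_fbmKernelPrimitive hH]
  ring

lemma integral_integral_fbmKernel_nonneg {H : ℝ} (hH : 1 / 2 < H) {a b c d : ℝ} (hab : a ≤ b)
    (hcd : c ≤ d) : 0 ≤ ∫ s in a..b, (∫ r in c..d, fbmKernel H (s - r)) :=
  intervalIntegral.integral_nonneg hab fun _ _ =>
    intervalIntegral.integral_nonneg hcd fun _ _ => fbmKernel_nonneg hH _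

lemma lintegral_lintegral_fbmKernel {H : ℝ} (hH : 1 / 2 < H) {a b c d : ℝ} (hab : a ≤ b)
    (hcd : c ≤ d) :
    ∫⁻ s in Ioc a b, ∫⁻ r in Ioc c d, ENNReal.ofReal (fbmKernel H (s - r)) =
      ENNReal.ofReal (∫ s in a..b, (∫ r in c..d, fbmKernel H (s - r))) := by
  have hc := continuous_fbmKernelPrimitive hH
  simp_rw [lintegral_fbmKernel_sub hH _ hcd, intervalIntegral.integral_of_le hab,
    integral_fbmKernel_sub hH]
  rw [ofReal_integral_eq_lintegral_ofReal]
  · exact (Continuous.integrableOn_Icc (by fun_prop)).mono_set Ioc_subset_Icc_self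
  · refine Eventually.of_forall fun s => ?_
    simp only [Pi.zero_apply]
    rw [← integral_fbmKernel_sub hH]
    exact intervalIntegral.integral_nonneg hcd fun r _ => fbmKernel_nonneg hH _

/-! ### The covariance measure -/

/-- The measure `fbmKernel H (s - r) ds dr` on the square `(0, t]²`. -/
noncomputable def fbmMeasure (H t : ℝ) : Measure (ℝ × ℝ) :=
  ((volume.restrict (Ioc 0 t)).prod (volume.restrict (Ioc 0 t))).withDensity
    fun z => ENNReal.ofReal (fbmKernel H (z.1 - z.2))

lemma lintegral_fbmMeasure (H t : ℝ) {F : ℝ × ℝ → ℝ≥0∞} (hF : Measurable F) :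
    ∫⁻ z, F z ∂fbmMeasure H t =
      ∫⁻ s in Ioc 0 t, ∫⁻ r in Ioc 0 t, ENNReal.ofReal (fbmKernel H (s - r)) * F (s, r) := by
  have hm : Measurable fun z : ℝ × ℝ => ENNReal.ofReal (fbmKernel H (z.1 - z.2)) := by fun_prop
  rw [fbmMeasure, lintegral_withDensity_eq_lintegral_mul _ hm hF, lintegral_prod _ (by fun_prop)]
  rfl

lemma fbmMeasure_Ioc_prod {H : ℝ} (hH : 1 / 2 < H) {t a b c d : ℝ} (ha : 0 ≤ a) (hab : a ≤ b)
    (hb : b ≤ t) (hc : 0 ≤ c) (hcd : c ≤ d) (hd : d ≤ t) :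
    fbmMeasure H t (Ioc a b ×ˢ Ioc c d) =
      ENNReal.ofReal (∫ s in a..b, (∫ r in c..d, fbmKernel H (s - r))) := by
  rw [← lintegral_lintegral_fbmKernel hH hab hcd, fbmMeasure,
    withDensity_apply _ (measurableSet_Ioc.prod measurableSet_Ioc), ← Measure.prod_restrict,
    lintegral_prod _ (by fun_prop), Measure.restrict_restrict measurableSet_Ioc,
    Measure.restrict_restrict measurableSet_Ioc, inter_eq_left.2 (Ioc_subset_Ioc ha hb),
    inter_eq_left.2 (Ioc_subset_Ioc hc hd)]

/-- The total mass that the kernel gives to `(-t, t]`; it bounds the density of the marginals of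
`fbmMeasure H t`. -/
noncomputable def fbmMass (H t : ℝ) : ℝ≥0∞ :=
  ∫⁻ u in Ioc (-t) t, ENNReal.ofReal (fbmKernel H u)

lemma fbmMass_ne_top {H : ℝ} (hH : 1 / 2 < H) {t : ℝ} (ht : 0 ≤ t) : fbmMass H t ≠ ∞ := by
  have h := lintegral_fbmKernel_sub hH 0 (c := -t) (d := t) (by linarith)
  simp only [zero_sub, fbmKernel_neg] at h
  rw [fbmMass, h]
  exact ENNReal.ofReal_ne_top

lemma lintegral_fbmKernel_sub_le (H : ℝ) {t s : ℝ} (hs : s ∈ Ioc 0 t) :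
    ∫⁻ r in Ioc 0 t, ENNReal.ofReal (fbmKernel H (s - r)) ≤ fbmMass H t := by
  rw [fbmMass, ← lintegral_indicator measurableSet_Ioc, ← lintegral_indicator measurableSet_Ioc,
    ← lintegral_sub_left_eq_self _ s]
  refine lintegral_mono fun r => ?_
  by_cases hr : s - r ∈ Ioc 0 t
  · rw [indicator_of_mem hr, indicator_of_mem]
    · simp
    · exact ⟨by linarith [hs.1, hr.2], by linarith [hs.2, hr.1]⟩
  · rw [indicator_of_notMem hr]
    exact bot_le

/-- The marginals of `fbmMeasure H t` have a density bounded by `fbmMass H t`. -/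
lemma lintegral_fbmMeasure_fst_le (H t : ℝ) {f : ℝ → ℝ≥0∞} (hf : Measurable f) :
    ∫⁻ z, f z.1 ∂fbmMeasure H t ≤ fbmMass H t * ∫⁻ s in Ioc 0 t, f s := by
  rw [lintegral_fbmMeasure H t (by fun_prop), ← lintegral_const_mul _ hf]
  refine setLIntegral_mono (by fun_prop) fun s hs => ?_
  dsimp only
  rw [lintegral_mul_const _ (by fun_prop)]
  gcongr
  exact lintegral_fbmKernel_sub_le H hs

lemma lintegral_fbmMeasure_swap (H t : ℝ) {F : ℝ × ℝ → ℝ≥0∞} (hF : Measurable F) :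
    ∫⁻ z, F z.swap ∂fbmMeasure H t = ∫⁻ z, F z ∂fbmMeasure H t := by
  rw [lintegral_fbmMeasure H t (by fun_prop), lintegral_fbmMeasure H t hF,
    lintegral_lintegral_swap (by fun_prop)]
  simp only [Prod.swap_prod_mk]
  refine lintegral_congr fun s => lintegral_congr fun r => ?_
  rw [← neg_sub, fbmKernel_neg]

/-- The bilinear form of the covariance kernel is bounded on `L²(0, t)`. -/
lemma lintegral_fbmMeasure_mul_le (H t : ℝ) {f : ℝ → ℝ≥0∞} (hf : Measurable f) :
    ∫⁻ z, f z.1 * f z.2 ∂fbmMeasure H t ≤ fbmMass H t * ∫⁻ s in Ioc 0 t, f s ^ 2 := by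
  have h1 : ∫⁻ z, f z.1 * f z.2 ∂fbmMeasure H t ≤
      (∫⁻ z, f z.1 ^ 2 ∂fbmMeasure H t) ^ (1 / 2 : ℝ)
        * (∫⁻ z, f z.2 ^ 2 ∂fbmMeasure H t) ^ (1 / 2 : ℝ) := by
    have := ENNReal.lintegral_mul_le_Lp_mul_Lq (fbmMeasure H t)
      (Real.HolderConjugate.two_two) (f := fun z => f z.1) (g := fun z => f z.2)
      (by fun_prop) (by fun_prop)
    simpa using this
  have h2 : ∫⁻ z, f z.2 ^ 2 ∂fbmMeasure H t = ∫⁻ z, f z.1 ^ 2 ∂fbmMeasure H t :=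
    lintegral_fbmMeasure_swap H t (F := fun z => f z.1 ^ 2) (by fun_prop)
  rw [h2, ← ENNReal.rpow_add_of_nonneg _ _ (by norm_num) (by norm_num)] at h1
  norm_num at h1
  exact h1.trans (lintegral_fbmMeasure_fst_le H t (by fun_prop))

/-! ### The variance of the exponential integrand -/

/-- The constant `C` in the bound `C / μ^(2H)` for the variance of `∫₀ᵗ exp(-μ (t - s)) dw(s)`. -/
noncomputable def expVarConst (H : ℝ) : ℝ :=
  2 * (H * (2 * H - 1)) * Real.Gamma (2 * H - 1) * 2 ^ (2 * H)

lemma expVarConst_pos {H : ℝ} (hH : 1 / 2 < H) : 0 < expVarConst H := by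
  have h1 : 0 < 2 * H - 1 := by linarith
  have h2 := Real.Gamma_pos_of_pos h1
  have h3 : 0 < H := by linarith
  unfold expVarConst
  positivity

lemma lintegral_fbmKernel_mul_exp {H : ℝ} (hH : 1 / 2 < H) {c : ℝ} (hc : 0 < c) :
    ∫⁻ u, ENNReal.ofReal (fbmKernel H u) * ENNReal.ofReal (Real.exp (-(c * |u|))) =
      ENNReal.ofReal (2 * (H * (2 * H - 1)) * ((1 / c) ^ (2 * H - 1) *
        Real.Gamma (2 * H - 1))) := by
  have h1 : 0 < 2 * H - 1 := by linarith
  have h2 := Real.Gamma_pos_of_pos h1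
  have h3 : 0 < H := by linarith
  have hint : ∫ u, fbmKernel H u * Real.exp (-(c * |u|)) =
      2 * (H * (2 * H - 1)) * ((1 / c) ^ (2 * H - 1) * Real.Gamma (2 * H - 1)) := by
    have h := integral_comp_abs
      (f := fun u => H * (2 * H - 1) * (u ^ (2 * H - 1 - 1) * Real.exp (-(c * u))))
    rw [integral_const_mul (μ := volume.restrict (Ioi 0)),
      Real.integral_rpow_mul_exp_neg_mul_Ioi h1 hc] at h
    rw [mul_assoc, ← h]
    refine integral_congr_ae (Eventually.of_forall fun u => ?_)
    simp only [fbmKernel, show 2 * H - 1 - 1 = 2 * H - 2 by ring]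
    ring
  have hi : Integrable fun u => fbmKernel H u * Real.exp (-(c * |u|)) := by
    refine Integrable.of_integral_ne_zero ?_
    rw [hint]
    positivity
  rw [← hint, ofReal_integral_eq_lintegral_ofReal hi]
  · refine lintegral_congr fun u => ?_
    rw [ENNReal.ofReal_mul (fbmKernel_nonneg hH u)]
  · exact Eventually.of_forall fun u => mul_nonneg (fbmKernel_nonneg hH u) (Real.exp_pos _).le

lemma lintegral_Ioc_exp_le {c : ℝ} (hc : 0 < c) {t : ℝ} (ht : 0 ≤ t) :
    ∫⁻ s in Ioc 0 t, ENNReal.ofReal (Real.exp (-(c * (t - s)))) ≤ ENNReal.ofReal (1 / c) := by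
  have hd : ∀ s : ℝ, HasDerivAt (fun s => 1 / c * Real.exp (-(c * (t - s))))
      (Real.exp (-(c * (t - s)))) s := by
    intro s
    have h1 : HasDerivAt (fun s => -(c * (t - s))) c s := by
      refine (((hasDerivAt_id s).const_sub t).const_mul c).fun_neg.congr_deriv ?_
      ring
    refine (h1.exp.const_mul (1 / c)).congr_deriv ?_
    field_simp
  have hcont : Continuous fun s => Real.exp (-(c * (t - s))) := by fun_prop
  rw [← ofReal_integral_eq_lintegral_ofReal
      ((intervalIntegrable_iff_integrableOn_Ioc_of_le ht).1 (hcont.intervalIntegrable 0 t))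
      (Eventually.of_forall fun s => (Real.exp_pos _).le),
    ← intervalIntegral.integral_of_le ht,
    intervalIntegral.integral_eq_sub_of_hasDerivAt (fun s _ => hd s)
      (hcont.intervalIntegrable 0 t)]
  refine ENNReal.ofReal_le_ofReal ?_
  simp only [sub_self, mul_zero, neg_zero, Real.exp_zero, mul_one, sub_le_self_iff]
  positivity

/-- The bound `O(μ^(-2H))` is uniform in `t`. It rests on
`(t - s) + (t - r) ≥ ((t - s) + |s - r|) / 2`, which splits the double integral into a product. -/
lemma lintegral_fbmMeasure_exp_le {H : ℝ} (hH : 1 / 2 < H) {μ : ℝ} (hμ : 0 < μ) {t : ℝ}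
    (ht : 0 ≤ t) :
    ∫⁻ z, ENNReal.ofReal (Real.exp (-(μ * (t - z.1))))
        * ENNReal.ofReal (Real.exp (-(μ * (t - z.2)))) ∂fbmMeasure H t ≤
      ENNReal.ofReal (expVarConst H / μ ^ (2 * H)) := by
  have hμ2 : 0 < μ / 2 := by positivity
  set K : ℝ := 2 * (H * (2 * H - 1)) * ((1 / (μ / 2)) ^ (2 * H - 1) * Real.Gamma (2 * H - 1))
    with hK
  have hinner : ∀ s ∈ Ioc 0 t, ∫⁻ r in Ioc 0 t, ENNReal.ofReal (fbmKernel H (s - r)) *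
      (ENNReal.ofReal (Real.exp (-(μ * (t - s)))) * ENNReal.ofReal (Real.exp (-(μ * (t - r))))) ≤
      ENNReal.ofReal (Real.exp (-(μ / 2 * (t - s)))) * ENNReal.ofReal K := by
    intro s hs
    rw [hK, ← lintegral_fbmKernel_mul_exp hH hμ2, ← lintegral_sub_left_eq_self
        (fun u => ENNReal.ofReal (fbmKernel H u) * ENNReal.ofReal (Real.exp (-(μ / 2 * |u|)))) s,
      ← lintegral_const_mul _ (by fun_prop)]
    refine (setLIntegral_mono (by fun_prop) fun r hr => ?_).trans (setLIntegral_le_lintegral _ _)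
    rw [mul_left_comm (ENNReal.ofReal (Real.exp (-(μ / 2 * (t - s))))),
      ← ENNReal.ofReal_mul (Real.exp_pos _).le, ← Real.exp_add,
      ← ENNReal.ofReal_mul (Real.exp_pos _).le, ← Real.exp_add]
    refine mul_le_mul_right (ENNReal.ofReal_le_ofReal (Real.exp_le_exp.2 ?_)) _
    have h1 := mul_nonneg hμ.le (sub_nonneg.2 hs.2)
    have h2 := mul_nonneg hμ.le (sub_nonneg.2 hr.2)
    rcases abs_cases (s - r) with ⟨h, -⟩ | ⟨h, -⟩ <;> rw [h] <;> nlinarith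
  rw [lintegral_fbmMeasure H t (by fun_prop)]
  refine (setLIntegral_mono (by fun_prop) hinner).trans ?_
  rw [lintegral_mul_const _ (by fun_prop)]
  refine (mul_le_mul_left (lintegral_Ioc_exp_le hμ2 ht) _).trans ?_
  rw [← ENNReal.ofReal_mul (by positivity)]
  refine ENNReal.ofReal_le_ofReal (le_of_eq ?_)
  have e1 : 1 / (μ / 2) = 2 / μ := by field_simp
  have e2 : (2 / μ) * (2 / μ) ^ (2 * H - 1) = 2 ^ (2 * H) / μ ^ (2 * H) := by
    rw [mul_comm, ← Real.rpow_add_one (by positivity), sub_add_cancel,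
      Real.div_rpow (by norm_num) hμ.le]
  rw [hK, e1, expVarConst]
  linear_combination 2 * (H * (2 * H - 1)) * Real.Gamma (2 * H - 1) * e2

/-! ### The Wiener integral of step functions -/

section WienerIntegral

lemma stronglyMeasurable_stepFun_eval {V : Type*} [NormedAddCommGroup V] {t : ℝ}
    (f : StepFun t V) : StronglyMeasurable f.eval := by
  unfold StepFun.eval
  exact Finset.stronglyMeasurable_fun_sum _ fun i _ =>
    stronglyMeasurable_const.indicator measurableSet_Ioc

variable {Ω : Type*} [MeasurableSpace Ω] {P : Measure Ω} {H T t : ℝ} {w : ℝ → Ω → ℝ}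

lemma IsFBm.memLp_two (hw : IsFBm H T w P) {s : ℝ} (hs : s ∈ Icc 0 T) : MemLp (w s) 2 P :=
  (hw.gaussian.hasGaussianLaw_eval ⟨s, hs⟩).memLp_two

lemma IsFBm.integral_mul [IsProbabilityMeasure P] (hw : IsFBm H T w P) {s r : ℝ}
    (hs : s ∈ Icc 0 T) (hr : r ∈ Icc 0 T) :
    ∫ ω, w s ω * w r ω ∂P = (s ^ (2 * H) + r ^ (2 * H) - |r - s| ^ (2 * H)) / 2 := by
  have h := covariance_eq_sub (hw.memLp_two hs) (hw.memLp_two hr)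
  rw [hw.covariance_eq s hs r hr, hw.centered s hs, zero_mul, sub_zero] at h
  exact h.symm

/-- The increments over two intervals have covariance `∬ fbmKernel H (s - r) ds dr`. For `H > 1/2`
the kernel is nonnegative and locally integrable. -/
lemma IsFBm.integral_increment_mul [IsProbabilityMeasure P] (hw : IsFBm H T w P)
    (hH : 1 / 2 < H) (htT : t ≤ T) {a b c d : ℝ} (ha : 0 ≤ a) (hab : a ≤ b)
    (hb : b ≤ t) (hc : 0 ≤ c) (hcd : c ≤ d) (hd : d ≤ t) :
    ∫ ω, (w b ω - w a ω) * (w d ω - w c ω) ∂P =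
      (fbmMeasure H t).real (Ioc a b ×ˢ Ioc c d) := by
  have ha' : a ∈ Icc 0 T := ⟨ha, by linarith⟩
  have hb' : b ∈ Icc 0 T := ⟨by linarith, by linarith⟩
  have hc' : c ∈ Icc 0 T := ⟨hc, by linarith⟩
  have hd' : d ∈ Icc 0 T := ⟨by linarith, by linarith⟩
  have hi : ∀ {s r : ℝ}, s ∈ Icc 0 T → r ∈ Icc 0 T → Integrable (fun ω => w s ω * w r ω) P :=
    fun hs hr => (hw.memLp_two hs).integrable_mul (hw.memLp_two hr)
  rw [measureReal_def, fbmMeasure_Ioc_prod hH ha hab hb hc hcd hd,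
    ENNReal.toReal_ofReal (integral_integral_fbmKernel_nonneg hH hab hcd),
    integral_integral_fbmKernel hH]
  have e : ∀ ω, (w b ω - w a ω) * (w d ω - w c ω) =
      (w b ω * w d ω - w b ω * w c ω) - (w a ω * w d ω - w a ω * w c ω) := fun ω => by ring
  simp_rw [e]
  have hi2 : ∀ {s : ℝ}, s ∈ Icc 0 T → Integrable (fun ω => w s ω * w d ω - w s ω * w c ω) P :=
    fun hs => (hi hs hd').sub (hi hs hc')
  rw [integral_sub (hi2 hb') (hi2 ha'),
    integral_sub (hi hb' hd') (hi hb' hc'), integral_sub (hi ha' hd') (hi ha' hc'),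
    hw.integral_mul hb' hd', hw.integral_mul hb' hc', hw.integral_mul ha' hd',
    hw.integral_mul ha' hc', abs_sub_comm d b, abs_sub_comm c b, abs_sub_comm d a,
    abs_sub_comm c a]
  ring

section InnerProductSpace

variable {V : Type*} [NormedAddCommGroup V] [InnerProductSpace ℝ V]

lemma memLp_sum_increment_smul (hw : IsFBm H T w P) (htT : t ≤ T) {ι : Type*} (S : Finset ι)
    {a b : ι → ℝ} (v : ι → V) (ha : ∀ i ∈ S, a i ∈ Icc 0 t) (hb : ∀ i ∈ S, b i ∈ Icc 0 t) :
    MemLp (fun ω => ∑ i ∈ S, (w (b i) ω - w (a i) ω) • v i) 2 P := by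
  refine memLp_finsetSum S fun i hi => ?_
  have h : MemLp (fun ω => w (b i) ω - w (a i) ω) 2 P :=
    (hw.memLp_two ⟨(hb i hi).1, (hb i hi).2.trans htT⟩).sub
      (hw.memLp_two ⟨(ha i hi).1, (ha i hi).2.trans htT⟩)
  exact (ContinuousLinearMap.toSpanSingleton ℝ (v i)).comp_memLp' h

/-- The isometry of the Wiener integral. The intervals may overlap, so that differences of step
functions with different nodes are covered. -/
lemma integral_norm_sq_sum_increment_smul [IsProbabilityMeasure P] (hw : IsFBm H T w P)
    (hH : 1 / 2 < H) (htT : t ≤ T) {ι : Type*} (S : Finset ι) {a b : ι → ℝ} (v : ι → V)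
    (hab : ∀ i ∈ S, a i ≤ b i) (ha : ∀ i ∈ S, a i ∈ Icc 0 t) (hb : ∀ i ∈ S, b i ∈ Icc 0 t) :
    ∫ ω, ‖∑ i ∈ S, (w (b i) ω - w (a i) ω) • v i‖ ^ 2 ∂P =
      ∫ z, inner ℝ (∑ i ∈ S, (Ioc (a i) (b i)).indicator (fun _ => v i) z.1)
        (∑ i ∈ S, (Ioc (a i) (b i)).indicator (fun _ => v i) z.2) ∂fbmMeasure H t := by
  have e1 : ∀ ω, ‖∑ i ∈ S, (w (b i) ω - w (a i) ω) • v i‖ ^ 2 =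
      ∑ i ∈ S, ∑ j ∈ S, (w (b i) ω - w (a i) ω) * (w (b j) ω - w (a j) ω)
        * inner ℝ (v i) (v j) := by
    intro ω
    rw [← real_inner_self_eq_norm_sq, sum_inner]
    refine Finset.sum_congr rfl fun i _ => ?_
    rw [inner_sum]
    refine Finset.sum_congr rfl fun j _ => ?_
    rw [real_inner_smul_left, real_inner_smul_right]
    ring
  have e2 : ∀ z : ℝ × ℝ, inner ℝ (∑ i ∈ S, (Ioc (a i) (b i)).indicator (fun _ => v i) z.1)
        (∑ i ∈ S, (Ioc (a i) (b i)).indicator (fun _ => v i) z.2) =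
      ∑ i ∈ S, ∑ j ∈ S, (Ioc (a i) (b i) ×ˢ Ioc (a j) (b j)).indicator
        (fun _ => inner ℝ (v i) (v j)) z := by
    intro z
    rw [sum_inner]
    refine Finset.sum_congr rfl fun i _ => ?_
    rw [inner_sum]
    refine Finset.sum_congr rfl fun j _ => ?_
    by_cases h1 : z.1 ∈ Ioc (a i) (b i) <;> by_cases h2 : z.2 ∈ Ioc (a j) (b j) <;>
      simp [indicator, h1, h2, mem_prod]
  simp_rw [e1, e2]
  have hL : ∀ i ∈ S, MemLp (fun ω => w (b i) ω - w (a i) ω) 2 P := fun i hi =>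
    (hw.memLp_two ⟨(hb i hi).1, (hb i hi).2.trans htT⟩).sub
      (hw.memLp_two ⟨(ha i hi).1, (ha i hi).2.trans htT⟩)
  have hI : ∀ i ∈ S, ∀ j ∈ S, Integrable (fun ω => (w (b i) ω - w (a i) ω)
      * (w (b j) ω - w (a j) ω) * inner ℝ (v i) (v j)) P := fun i hi j hj =>
    ((hL i hi).integrable_mul (hL j hj)).mul_const _
  have hJ : ∀ i ∈ S, ∀ j ∈ S, Integrable ((Ioc (a i) (b i) ×ˢ Ioc (a j) (b j)).indicator
        (fun _ => inner ℝ (v i) (v j))) (fbmMeasure H t) := by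
    intro i hi j hj
    rw [integrable_indicator_iff (measurableSet_Ioc.prod measurableSet_Ioc)]
    refine integrableOn_const ?_
    rw [fbmMeasure_Ioc_prod hH (ha i hi).1 (hab i hi) (hb i hi).2 (ha j hj).1 (hab j hj)
      (hb j hj).2]
    exact ENNReal.ofReal_ne_top
  rw [integral_finsetSum _ fun i hi => integrable_finsetSum _ fun j hj => hI i hi j hj,
    integral_finsetSum _ fun i hi => integrable_finsetSum _ fun j hj => hJ i hi j hj]
  refine Finset.sum_congr rfl fun i hi => ?_
  rw [integral_finsetSum _ fun j hj => hI i hi j hj,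
    integral_finsetSum _ fun j hj => hJ i hi j hj]
  refine Finset.sum_congr rfl fun j hj => ?_
  rw [integral_mul_const, hw.integral_increment_mul hH htT (ha i hi).1 (hab i hi) (hb i hi).2
    (ha j hj).1 (hab j hj) (hb j hj).2, integral_indicator_const _
    (measurableSet_Ioc.prod measurableSet_Ioc), smul_eq_mul]

lemma lintegral_enorm_sq_sum_increment_smul_le [IsProbabilityMeasure P] (hw : IsFBm H T w P)
    (hH : 1 / 2 < H) (htT : t ≤ T) {ι : Type*} (S : Finset ι) {a b : ι → ℝ} (v : ι → V)
    (hab : ∀ i ∈ S, a i ≤ b i) (ha : ∀ i ∈ S, a i ∈ Icc 0 t) (hb : ∀ i ∈ S, b i ∈ Icc 0 t) :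
    ∫⁻ ω, ‖∑ i ∈ S, (w (b i) ω - w (a i) ω) • v i‖ₑ ^ 2 ∂P ≤
      ∫⁻ z, ‖∑ i ∈ S, (Ioc (a i) (b i)).indicator (fun _ => v i) z.1‖ₑ
        * ‖∑ i ∈ S, (Ioc (a i) (b i)).indicator (fun _ => v i) z.2‖ₑ ∂fbmMeasure H t := by
  have h1 : ∫⁻ ω, ‖∑ i ∈ S, (w (b i) ω - w (a i) ω) • v i‖ₑ ^ 2 ∂P =
      ENNReal.ofReal (∫ ω, ‖∑ i ∈ S, (w (b i) ω - w (a i) ω) • v i‖ ^ 2 ∂P) := by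
    rw [ofReal_integral_eq_lintegral_ofReal
      (memLp_sum_increment_smul hw htT S v ha hb).integrable_norm_pow'
      (Eventually.of_forall fun ω => by positivity)]
    refine lintegral_congr fun ω => ?_
    rw [← ofReal_norm, ENNReal.ofReal_pow (norm_nonneg _)]
  rw [h1, integral_norm_sq_sum_increment_smul hw hH htT S v hab ha hb]
  refine (Real.ofReal_le_enorm _).trans ((enorm_integral_le_lintegral_enorm _).trans ?_)
  refine lintegral_mono fun z => ?_
  rw [← ofReal_norm, ← ofReal_norm, ← ofReal_norm,
    ← ENNReal.ofReal_mul (norm_nonneg _)]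
  exact ENNReal.ofReal_le_ofReal (norm_inner_le_norm _ _)

lemma IsFBm.memLp_stepFun_integral (hw : IsFBm H T w P) (htT : t ≤ T) (f : StepFun t V) :
    MemLp (f.integral w) 2 P :=
  memLp_sum_increment_smul hw htT _ _ (fun i _ => f.node_mem i) fun i _ => f.node_mem (i + 1)

lemma IsFBm.lintegral_stepFun_integral_le [IsProbabilityMeasure P] (hw : IsFBm H T w P)
    (hH : 1 / 2 < H) (htT : t ≤ T) (f : StepFun t V) :
    ∫⁻ ω, ‖f.integral w ω‖ₑ ^ 2 ∂P ≤
      ∫⁻ z, ‖f.eval z.1‖ₑ * ‖f.eval z.2‖ₑ ∂fbmMeasure H t :=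
  lintegral_enorm_sq_sum_increment_smul_le hw hH htT _ _
    (fun i _ => f.node_mono (Nat.le_succ i)) (fun i _ => f.node_mem i)
    fun i _ => f.node_mem (i + 1)

lemma eLpNorm_two_eq_lintegral {α E : Type*} [MeasurableSpace α] [NormedAddCommGroup E]
    (f : α → E) (μ : Measure α) :
    eLpNorm f 2 μ = (∫⁻ x, ‖f x‖ₑ ^ 2 ∂μ) ^ (1 / 2 : ℝ) := by
  rw [eLpNorm_eq_lintegral_rpow_enorm_toReal (by norm_num) (by norm_num)]
  simp

/-- The Wiener integral is bounded from `L²(0, t; V)` to `L²(Ω; V)`. -/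
lemma IsFBm.eLpNorm_stepFun_integral_sub_le [IsProbabilityMeasure P] (hw : IsFBm H T w P)
    (hH : 1 / 2 < H) (htT : t ≤ T) (f g : StepFun t V) :
    eLpNorm (fun ω => f.integral w ω - g.integral w ω) 2 P ≤
      fbmMass H t ^ (1 / 2 : ℝ)
        * eLpNorm (fun s => f.eval s - g.eval s) 2 (volume.restrict (Ioc 0 t)) := by
  classical
  rw [eLpNorm_two_eq_lintegral, eLpNorm_two_eq_lintegral,
    ← ENNReal.mul_rpow_of_nonneg _ _ (by norm_num)]
  refine ENNReal.rpow_le_rpow ?_ (by norm_num)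
  have hm : Measurable fun s => ‖f.eval s - g.eval s‖ₑ :=
    ((stronglyMeasurable_stepFun_eval f).sub (stronglyMeasurable_stepFun_eval g)).enorm
  refine le_trans ?_ (lintegral_fbmMeasure_mul_le H t hm)
  have h := lintegral_enorm_sq_sum_increment_smul_le hw hH htT
    ((Finset.range f.size).disjSum (Finset.range g.size))
    (a := Sum.elim f.node g.node) (b := Sum.elim (fun i => f.node (i + 1)) fun i => g.node (i + 1))
    (Sum.elim f.value (-g.value))
    (by rintro (i | i) _; exacts [f.node_mono (Nat.le_succ i), g.node_mono (Nat.le_succ i)])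
    (by rintro (i | i) _; exacts [f.node_mem i, g.node_mem i])
    (by rintro (i | i) _; exacts [f.node_mem _, g.node_mem _])
  have ind_neg : ∀ (A : Set ℝ) (v : V) (s : ℝ),
      A.indicator (fun _ => -v) s = -A.indicator (fun _ => v) s := by
    intro A v s
    by_cases hs : s ∈ A <;> simp [hs]
  simp only [Finset.sum_disjSum, Sum.elim_inl, Sum.elim_inr, Pi.neg_apply, smul_neg, ind_neg,
    Finset.sum_neg_distrib, ← sub_eq_add_neg] at h
  exact h

/-- The Wiener integral does not depend on the approximating step functions. -/
lemma IsWienerIntegral.tendsto_of_tendsto [IsProbabilityMeasure P] (hw : IsFBm H T w P)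
    (hH : 1 / 2 < H) (ht : 0 ≤ t) (htT : t ≤ T) {G : ℝ → V} {X : Ω → V}
    (hX : IsWienerIntegral w t G X P) {g : ℕ → StepFun t V}
    (hg : Tendsto (fun n => eLpNorm (fun s => G s - (g n).eval s) 2 (volume.restrict (Ioc 0 t)))
      atTop (𝓝 0)) :
    Tendsto (fun n => eLpNorm (fun ω => X ω - (g n).integral w ω) 2 P) atTop (𝓝 0) := by
  obtain ⟨hG, hXm, f, hf, hfX⟩ := hX
  have hbound : ∀ n, eLpNorm (fun ω => X ω - (g n).integral w ω) 2 P ≤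
      eLpNorm (fun ω => X ω - (f n).integral w ω) 2 P + fbmMass H t ^ (1 / 2 : ℝ) *
        (eLpNorm (fun s => G s - (f n).eval s) 2 (volume.restrict (Ioc 0 t)) +
          eLpNorm (fun s => G s - (g n).eval s) 2 (volume.restrict (Ioc 0 t))) := by
    intro n
    have hfm := (hw.memLp_stepFun_integral htT (f n)).aestronglyMeasurable
    have hgm := (hw.memLp_stepFun_integral htT (g n)).aestronglyMeasurable
    have hfe := (stronglyMeasurable_stepFun_eval (f n)).aestronglyMeasurable
      (μ := volume.restrict (Ioc 0 t))
    have hge := (stronglyMeasurable_stepFun_eval (g n)).aestronglyMeasurable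
      (μ := volume.restrict (Ioc 0 t))
    have h1 := eLpNorm_add_le (hXm.sub hfm) (hfm.sub hgm) (p := 2) (by norm_num)
    simp only [sub_add_sub_cancel] at h1
    refine h1.trans (add_le_add le_rfl ((hw.eLpNorm_stepFun_integral_sub_le hH htT _ _).trans ?_))
    gcongr
    have h2 := eLpNorm_sub_le (hG.sub hge) (hG.sub hfe) (p := 2) (by norm_num)
    simp only [sub_sub_sub_cancel_left] at h2
    rw [add_comm]
    exact h2
  have hlim := hfX.add (ENNReal.Tendsto.const_mul (hf.add hg)
    (Or.inr (ENNReal.rpow_ne_top_of_nonneg (by norm_num : (0:ℝ) ≤ 1 / 2) (fbmMass_ne_top hH ht))))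
  simp only [add_zero, mul_zero] at hlim
  exact tendsto_of_tendsto_of_tendsto_of_le_of_le tendsto_const_nhds hlim (fun _ => bot_le) hbound

lemma exists_isWienerIntegral [CompleteSpace V] [IsProbabilityMeasure P] (hw : IsFBm H T w P)
    (hH : 1 / 2 < H) (ht : 0 ≤ t) (htT : t ≤ T) {G : ℝ → V}
    (hG : AEStronglyMeasurable G (volume.restrict (Ioc 0 t))) {g : ℕ → StepFun t V}
    (hg : Tendsto (fun n => eLpNorm (fun s => G s - (g n).eval s) 2 (volume.restrict (Ioc 0 t)))
      atTop (𝓝 0)) :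
    ∃ X : Ω → V, MemLp X 2 P ∧ IsWienerIntegral w t G X P := by
  set c : ℝ≥0∞ := fbmMass H t ^ (1 / 2 : ℝ)
  have hc : c ≠ ∞ := ENNReal.rpow_ne_top_of_nonneg (by norm_num) (fbmMass_ne_top hH ht)
  have hmem := fun n => hw.memLp_stepFun_integral htT (g n)
  set F : ℕ → Lp V 2 P := fun n => (hmem n).toLp _ with hF
  set ε : ℕ → ℝ≥0∞ :=
    fun n => c * eLpNorm (fun s => G s - (g n).eval s) 2 (volume.restrict (Ioc 0 t)) with hε
  have hε0 : Tendsto ε atTop (𝓝 0) := by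
    have h := ENNReal.Tendsto.const_mul hg (Or.inr hc)
    rwa [mul_zero] at h
  have hbound : ∀ m n, edist (F m) (F n) ≤ ε m + ε n := by
    intro m n
    rw [hF, Lp.edist_toLp_toLp]
    refine (hw.eLpNorm_stepFun_integral_sub_le hH htT (g m) (g n)).trans ?_
    have hme := (stronglyMeasurable_stepFun_eval (g m)).aestronglyMeasurable
      (μ := volume.restrict (Ioc 0 t))
    have hne := (stronglyMeasurable_stepFun_eval (g n)).aestronglyMeasurable
      (μ := volume.restrict (Ioc 0 t))
    have h2 := eLpNorm_sub_le (hG.sub hne) (hG.sub hme) (p := 2) (by norm_num)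
    simp only [sub_sub_sub_cancel_left] at h2
    rw [hε, ← mul_add, add_comm]
    gcongr
    exact h2
  have hcauchy : CauchySeq F := by
    rw [EMetric.cauchySeq_iff]
    intro δ hδ
    have h2 : 0 < δ / 2 := ENNReal.half_pos hδ.ne'
    obtain ⟨N, hN⟩ := eventually_atTop.1 ((tendsto_order.1 hε0).2 _ h2)
    refine ⟨N, fun m hm n hn => (hbound m n).trans_lt ?_⟩
    calc ε m + ε n < δ / 2 + δ / 2 := ENNReal.add_lt_add (hN m hm) (hN n hn)
      _ = δ := ENNReal.add_halves δ
  obtain ⟨X, hX⟩ := cauchySeq_tendsto_of_complete hcauchy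
  refine ⟨X, Lp.memLp X, hG, (Lp.memLp X).1, g, hg, ?_⟩
  rw [tendsto_iff_edist_tendsto_0] at hX
  refine hX.congr fun n => ?_
  rw [edist_comm, Lp.edist_def]
  refine eLpNorm_congr_ae ?_
  filter_upwards [(hmem n).coeFn_toLp] with ω hω
  simp only [Pi.sub_apply, hF, hω]

end InnerProductSpace

end WienerIntegral

/-! ### Gaussian moments -/

/-- The absolute moment of order `p` of the standard normal distribution. -/
noncomputable def gaussianMoment (p : ℝ) : ℝ≥0∞ := ∫⁻ x, ‖x‖ₑ ^ p ∂gaussianReal 0 1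

lemma gaussianMoment_ne_top {p : ℝ} (hp : 0 < p) : gaussianMoment p ≠ ∞ := by
  have h := (memLp_id_gaussianReal (μ := 0) (v := 1) p.toNNReal).2
  rw [eLpNorm_lt_top_iff_lintegral_rpow_enorm_lt_top (by simpa using hp) (by simp)] at h
  simp only [ENNReal.coe_toReal, Real.coe_toNNReal _ hp.le, id] at h
  exact h.ne

section Gaussian

variable {Ω : Type*} [MeasurableSpace Ω] {P : Measure Ω}

/-- A centred Gaussian variable is distributed as `√v` times a standard one, so its absolute moments
are powers of its variance `v`. -/
lemma lintegral_enorm_rpow_of_hasGaussianLaw {Y : Ω → ℝ} (hY : HasGaussianLaw Y P)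
    (h0 : ∫ ω, Y ω ∂P = 0) {p : ℝ} (hp : 0 ≤ p) :
    ∫⁻ ω, ‖Y ω‖ₑ ^ p ∂P = gaussianMoment p * ENNReal.ofReal (Var[Y; P]) ^ (p / 2) := by
  have hv : 0 ≤ Var[Y; P] := variance_nonneg _ _
  have h1 := hY.map_eq_gaussianReal
  rw [h0] at h1
  have h2 := gaussianReal_map_const_mul (μ := 0) (v := 1) (Real.sqrt (Var[Y; P]))
  have h3 : (⟨Real.sqrt (Var[Y; P]) ^ 2, sq_nonneg _⟩ : NNReal) * 1 = (Var[Y; P]).toNNReal := by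
    ext
    simp [Real.sq_sqrt hv, hv]
  have h4 : P.map Y = (gaussianReal 0 1).map (Real.sqrt (Var[Y; P]) * ·) := by
    rw [h1, h2, mul_zero, ← h3]
    rfl
  have hm : Measurable fun y : ℝ => ‖y‖ₑ ^ p := by fun_prop
  have e1 : ∫⁻ ω, ‖Y ω‖ₑ ^ p ∂P = ∫⁻ y, ‖y‖ₑ ^ p ∂P.map Y :=
    (lintegral_map' hm.aemeasurable hY.aemeasurable).symm
  rw [e1, h4, lintegral_map (by fun_prop) (by fun_prop), gaussianMoment, mul_comm,
    ← lintegral_const_mul _ (by fun_prop)]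
  refine lintegral_congr fun x => ?_
  rw [enorm_mul, ENNReal.mul_rpow_of_nonneg _ _ hp, Real.enorm_of_nonneg (Real.sqrt_nonneg _),
    Real.sqrt_eq_rpow, ← ENNReal.ofReal_rpow_of_nonneg hv (by norm_num), ← ENNReal.rpow_mul]
  congr 2
  ring

variable {H T t : ℝ}

lemma IsFBm.hasGaussianLaw_stepFun_integral {w : ℝ → Ω → ℝ} (hw : IsFBm H T w P) (htT : t ≤ T)
    (f : StepFun t ℝ) : HasGaussianLaw (f.integral w) P := by
  have hmem : ∀ i, f.node i ∈ Icc 0 T := fun i => ⟨(f.node_mem i).1, (f.node_mem i).2.trans htT⟩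
  have h := hw.gaussian.of_isGaussianProcess (S := Unit) (Y := fun _ => f.integral w) fun _ => by
    classical
    refine ⟨(Finset.range (f.size + 1)).image fun i => ⟨f.node i, hmem i⟩,
      ∑ i ∈ (Finset.range f.size).attach, f.value i •
        (ContinuousLinearMap.proj (R := ℝ) ⟨⟨f.node (i + 1), hmem _⟩, Finset.mem_image_of_mem _
          (Finset.mem_range.2 (by have := Finset.mem_range.1 i.2; omega))⟩ -
        ContinuousLinearMap.proj (R := ℝ) ⟨⟨f.node i, hmem _⟩, Finset.mem_image_of_mem _
          (Finset.mem_range.2 (by have := Finset.mem_range.1 i.2; omega))⟩), fun ω => ?_⟩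
    simp only [_root_.sum_apply, _root_.smul_apply, _root_.sub_apply,
      ContinuousLinearMap.proj_apply, Finset.restrict, smul_eq_mul,
      StepFun.integral]
    rw [← Finset.sum_attach]
    exact Finset.sum_congr rfl fun i _ => mul_comm _ _
  exact h.hasGaussianLaw_eval ()

lemma IsFBm.integral_stepFun_integral {w : ℝ → Ω → ℝ} (hw : IsFBm H T w P) (htT : t ≤ T)
    (f : StepFun t ℝ) : ∫ ω, f.integral w ω ∂P = 0 := by
  have hmem : ∀ i, f.node i ∈ Icc 0 T := fun i => ⟨(f.node_mem i).1, (f.node_mem i).2.trans htT⟩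
  have hi : ∀ i, Integrable (w (f.node i)) P := fun i =>
    (hw.gaussian.hasGaussianLaw_eval ⟨_, hmem i⟩).integrable
  unfold StepFun.integral
  have hi' : ∀ i, Integrable (fun ω => (w (f.node (i + 1)) ω - w (f.node i) ω) • f.value i) P :=
    fun i => ((hi (i + 1)).sub (hi i)).smul_const _
  rw [integral_finsetSum _ fun i _ => hi' i]
  refine Finset.sum_eq_zero fun i _ => ?_
  rw [integral_smul_const, integral_sub (hi _) (hi _), hw.centered _ (hmem _),
    hw.centered _ (hmem _), sub_zero, zero_smul]

lemma IsCylindricalFBm.iIndepFun_stepFun_integral {w : ℕ → ℝ → Ω → ℝ}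
    (hw : IsCylindricalFBm H T w P) (htT : t ≤ T) (f : ℕ → StepFun t ℝ) :
    iIndepFun (fun k => (f k).integral (w k)) P := by
  have hmem : ∀ k i, (f k).node i ∈ Icc 0 T := fun k i =>
    ⟨((f k).node_mem i).1, ((f k).node_mem i).2.trans htT⟩
  exact hw.indep.comp (fun k path => ∑ i ∈ Finset.range (f k).size,
    (path ⟨(f k).node (i + 1), hmem k _⟩ - path ⟨(f k).node i, hmem k _⟩) • (f k).value i)
    fun k => by fun_prop

/-- All moments of a linear combination of independent Wiener integrals of step functions are
controlled by its variance. -/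
lemma IsCylindricalFBm.lintegral_enorm_sum_rpow_le [IsProbabilityMeasure P] {w : ℕ → ℝ → Ω → ℝ}
    (hw : IsCylindricalFBm H T w P) (htT : t ≤ T) (f : ℕ → StepFun t ℝ) {v : ℕ → ℝ}
    (hv : ∀ k, 0 ≤ v k)
    (hfv : ∀ k, ∫⁻ ω, ‖(f k).integral (w k) ω‖ₑ ^ 2 ∂P ≤ ENNReal.ofReal (v k)) (c : ℕ → ℝ) (n : ℕ)
    {p : ℝ} (hp : 0 ≤ p) :
    ∫⁻ ω, ‖∑ k ∈ Finset.range n, (f k).integral (w k) ω * c k‖ₑ ^ p ∂P ≤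
      gaussianMoment p * ENNReal.ofReal (∑ k ∈ Finset.range n, v k * c k ^ 2) ^ (p / 2) := by
  set X : ℕ → Ω → ℝ := fun k ω => (f k).integral (w k) ω * c k with hX
  have hg : ∀ k, HasGaussianLaw ((f k).integral (w k)) P := fun k =>
    (hw.isFBm k).hasGaussianLaw_stepFun_integral htT (f k)
  have hXg : ∀ k, HasGaussianLaw (X k) P := fun k => by
    have h := (hg k).fun_smul (c k)
    simpa only [hX, smul_eq_mul, mul_comm] using h
  have hXi : iIndepFun X P :=
    (hw.iIndepFun_stepFun_integral htT f).comp (fun k x => x * c k) fun k => by fun_prop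
  have hXi' : iIndepFun (fun k : Fin n => X k) P := hXi.precomp Fin.val_injective
  have hsum : HasGaussianLaw (fun ω => ∑ k ∈ Finset.range n, X k ω) P := by
    have h := iIndepFun.hasGaussianLaw_fun_sum (fun k : Fin n => hXg k) hXi'
    simpa only [Finset.sum_range] using h
  have h0 : ∫ ω, ∑ k ∈ Finset.range n, X k ω ∂P = 0 := by
    rw [integral_finsetSum _ fun k _ => (hXg k).integrable]
    refine Finset.sum_eq_zero fun k _ => ?_
    rw [hX, integral_mul_const, (hw.isFBm k).integral_stepFun_integral htT, zero_mul]
  rw [lintegral_enorm_rpow_of_hasGaussianLaw hsum h0 hp]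
  gcongr
  have hvar : Var[fun ω => ∑ k ∈ Finset.range n, X k ω; P] =
      ∑ k ∈ Finset.range n, Var[X k; P] := by
    have h := IndepFun.variance_sum (s := Finset.range n) (fun k _ => (hXg k).memLp_two)
      (fun i _ j _ hij => hXi.indepFun hij)
    rw [← h]
    congr 1
    ext ω
    simp
  rw [hvar]
  refine Finset.sum_le_sum fun k _ => ?_
  have hvk : Var[(f k).integral (w k); P] ≤ v k := by
    rw [← ENNReal.ofReal_le_ofReal_iff (hv k), variance_of_integral_eq_zero (hg k).aemeasurable
      ((hw.isFBm k).integral_stepFun_integral htT _), ofReal_integral_eq_lintegral_ofReal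
        (hg k).memLp_two.integrable_sq (Eventually.of_forall fun ω => sq_nonneg _)]
    refine le_trans (le_of_eq (lintegral_congr fun ω => ?_)) (hfv k)
    rw [← ofReal_norm, ← ENNReal.ofReal_pow (norm_nonneg _), Real.norm_eq_abs, sq_abs]
  have : Var[X k; P] = Var[(f k).integral (w k); P] * c k ^ 2 := by
    rw [hX, variance_mul_const]
  rw [this]
  gcongr

end Gaussian

/-! ### Chaining along dyadic points -/

section Chaining

variable {Ω : Type*} [MeasurableSpace Ω] {P : Measure Ω}

/-- Minkowski's inequality for series. -/
lemma lintegral_tsum_rpow_le {D : ℕ → Ω → ℝ≥0∞} (hD : ∀ n, Measurable (D n)) {p : ℝ}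
    (hp : 1 ≤ p) :
    (∫⁻ ω, (∑' n, D n ω) ^ p ∂P) ^ (1 / p) ≤ ∑' n, (∫⁻ ω, D n ω ^ p ∂P) ^ (1 / p) := by
  have hp0 : 0 < p := by linarith
  have hfin : ∀ N : ℕ, (∫⁻ ω, (∑ n ∈ Finset.range N, D n ω) ^ p ∂P) ^ (1 / p) ≤
      ∑ n ∈ Finset.range N, (∫⁻ ω, D n ω ^ p ∂P) ^ (1 / p) := by
    intro N
    induction N with
    | zero => simp [hp0]
    | succ N ih =>
      simp only [Finset.sum_range_succ]
      refine (ENNReal.lintegral_Lp_add_le (f := fun ω => ∑ n ∈ Finset.range N, D n ω)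
        (by fun_prop) (hD N).aemeasurable hp).trans ?_
      gcongr
  have hlim : Tendsto (fun N => ∫⁻ ω, (∑ n ∈ Finset.range N, D n ω) ^ p ∂P) atTop
      (𝓝 (∫⁻ ω, (∑' n, D n ω) ^ p ∂P)) := by
    refine lintegral_tendsto_of_tendsto_of_monotone (fun N => by fun_prop)
      (Eventually.of_forall fun ω => ?_) (Eventually.of_forall fun ω => ?_)
    · intro a b hab
      dsimp only
      gcongr
    · exact (ENNReal.continuous_rpow_const.tendsto _).comp (ENNReal.tendsto_nat_tsum _)
  have hlim2 := (ENNReal.continuous_rpow_const (y := 1 / p)).tendsto _ |>.comp hlim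
  exact le_of_tendsto' hlim2 fun N => (hfin N).trans (ENNReal.sum_le_tsum _)

/-- The `ℓᵖ` norm of the increments of `S` over the dyadic intervals of length `2⁻ⁿ`. -/
noncomputable def dyadicIncrement (p : ℝ) (S : ℝ → ℝ) (n : ℕ) : ℝ≥0∞ :=
  (∑ j ∈ Finset.range (2 ^ n), ‖S ((j + 1) / 2 ^ n) - S (j / 2 ^ n)‖ₑ ^ p) ^ (1 / p)

lemma enorm_sub_le_dyadicIncrement {p : ℝ} (hp : 0 < p) (S : ℝ → ℝ) {n j : ℕ} (hj : j < 2 ^ n) :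
    ‖S ((j + 1) / 2 ^ n) - S (j / 2 ^ n)‖ₑ ≤ dyadicIncrement p S n := by
  have h : ‖S ((j + 1) / 2 ^ n) - S (j / 2 ^ n)‖ₑ ^ p ≤
      ∑ j ∈ Finset.range (2 ^ n), ‖S ((j + 1) / 2 ^ n) - S (j / 2 ^ n)‖ₑ ^ p :=
    Finset.single_le_sum (f := fun j : ℕ => ‖S ((j + 1) / 2 ^ n) - S (j / 2 ^ n)‖ₑ ^ p)
      (fun _ _ => bot_le) (Finset.mem_range.2 hj)
  have h2 := ENNReal.rpow_le_rpow h (by positivity : 0 ≤ 1 / p)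
  rwa [← ENNReal.rpow_mul, mul_one_div_cancel hp.ne', ENNReal.rpow_one] at h2

lemma enorm_le_tsum_dyadicIncrement {p : ℝ} (hp : 0 < p) {S : ℝ → ℝ} (hS : Continuous S)
    (h0 : S 0 = 0) {x : ℝ} (hx : x ∈ Ioo (0 : ℝ) 1) :
    ‖S x‖ₑ ≤ ∑' n, dyadicIncrement p S (n + 1) := by
  -- `y n` is the largest dyadic point of level `n` below `x`; `y (n + 1)` is `y n` or its right
  -- neighbour at level `n + 1`.
  set y : ℕ → ℝ := fun n => (⌊x * 2 ^ n⌋₊ : ℝ) / 2 ^ n with hy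
  have hstep : ∀ n, ‖S (y (n + 1)) - S (y n)‖ₑ ≤ dyadicIncrement p S (n + 1) := by
    intro n
    set m := ⌊x * 2 ^ n⌋₊ with hm
    have hxn : 0 ≤ x * 2 ^ n := mul_nonneg hx.1.le (by positivity)
    have h1 : (m : ℝ) ≤ x * 2 ^ n := Nat.floor_le hxn
    have h2 : x * 2 ^ n < m + 1 := Nat.lt_floor_add_one _
    have hm1 : m < 2 ^ n := by
      have h : (m : ℝ) < 2 ^ n :=
        h1.trans_lt (mul_lt_of_lt_one_left (by positivity) hx.2)
      exact_mod_cast h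
    have hyn : y n = ((2 * m : ℕ) : ℝ) / 2 ^ (n + 1) := by
      simp only [hy, ← hm]
      push_cast
      rw [pow_succ]
      field_simp
    rcases lt_or_ge (x * 2 ^ (n + 1)) (2 * m + 1) with h | h
    · have : ⌊x * 2 ^ (n + 1)⌋₊ = 2 * m := by
        rw [Nat.floor_eq_iff (by positivity [hx.1])]
        push_cast
        constructor
        · rw [pow_succ]; linarith
        · exact h
      have hyn1 : y (n + 1) = y n := by
        rw [hyn]
        simp only [hy, this]
      rw [hyn1, sub_self, enorm_zero]
      exact bot_le
    · have : ⌊x * 2 ^ (n + 1)⌋₊ = 2 * m + 1 := by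
        rw [Nat.floor_eq_iff (by positivity [hx.1])]
        push_cast
        constructor
        · exact h
        · rw [pow_succ]; linarith
      have hyn1 : y (n + 1) = (((2 * m : ℕ) : ℝ) + 1) / 2 ^ (n + 1) := by
        simp only [hy, this]
        push_cast
        rfl
      rw [hyn1, hyn]
      refine enorm_sub_le_dyadicIncrement hp S ?_
      rw [pow_succ]
      omega
  have hy0 : S (y 0) = 0 := by
    have : ⌊x⌋₊ = 0 := Nat.floor_eq_zero.2 hx.2
    simp [hy, this, h0]
  have hsum : ∀ N, ‖S (y N)‖ₑ ≤ ∑ n ∈ Finset.range N, dyadicIncrement p S (n + 1) := by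
    intro N
    induction N with
    | zero => simp [hy0]
    | succ N ih =>
      rw [Finset.sum_range_succ]
      calc ‖S (y (N + 1))‖ₑ = ‖S (y N) + (S (y (N + 1)) - S (y N))‖ₑ := by congr 1; ring
        _ ≤ ‖S (y N)‖ₑ + ‖S (y (N + 1)) - S (y N)‖ₑ := enorm_add_le _ _
        _ ≤ _ := add_le_add ih (hstep N)
  have hlim : Tendsto y atTop (𝓝 x) :=
    (tendsto_nat_floor_mul_div_atTop hx.1.le).comp
      (tendsto_pow_atTop_atTop_of_one_lt (one_lt_two (α := ℝ)))
  have hlim2 : Tendsto (fun n => ‖S (y n)‖ₑ) atTop (𝓝 ‖S x‖ₑ) :=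
    (continuous_enorm.tendsto _).comp ((hS.tendsto x).comp hlim)
  exact le_of_tendsto' hlim2 fun N => (hsum N).trans (ENNReal.sum_le_tsum _)

/-- The constant produced by chaining when increments over distance `d` have `p`-th moment of order
`d^q`: the sum of the levels' contributions `2^(-n (q - 1) / p)`. -/
noncomputable def chainingConst (p q : ℝ) : ℝ≥0∞ :=
  ∑' n : ℕ, ((2 : ℝ≥0∞) ^ (-((q - 1) / p))) ^ (n + 1)

lemma chainingConst_ne_top {p q : ℝ} (hp : 0 < p) (hq : 1 < q) : chainingConst p q ≠ ∞ := by
  have h : (2 : ℝ≥0∞) ^ (-((q - 1) / p)) < 1 :=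
    ENNReal.rpow_lt_one_of_one_lt_of_neg (by norm_num)
      (neg_neg_of_pos (div_pos (by linarith) hp))
  rw [chainingConst, ENNReal.tsum_geometric_add_one]
  refine ENNReal.mul_ne_top h.ne_top ?_
  rw [Ne, ENNReal.inv_eq_top, tsub_eq_zero_iff_le, not_le]
  exact h

lemma lintegral_dyadicIncrement_rpow_le {S : Ω → ℝ → ℝ} (hmeas : ∀ x, Measurable fun ω => S ω x)
    {p q : ℝ} (hp : 0 < p) {K : ℝ≥0∞}
    (hinc : ∀ x ∈ Icc (0 : ℝ) 1, ∀ y ∈ Icc (0 : ℝ) 1,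
      ∫⁻ ω, ‖S ω x - S ω y‖ₑ ^ p ∂P ≤ K * ENNReal.ofReal |x - y| ^ q) (n : ℕ) :
    (∫⁻ ω, dyadicIncrement p (S ω) n ^ p ∂P) ^ (1 / p) ≤
      K ^ (1 / p) * ((2 : ℝ≥0∞) ^ (-((q - 1) / p))) ^ n := by
  have h2 : (2 : ℝ≥0∞) ≠ 0 := by norm_num
  have h2' : (2 : ℝ≥0∞) ≠ ∞ := by norm_num
  have hm : ∀ j : ℕ, Measurable fun ω => ‖S ω ((j + 1) / 2 ^ n) - S ω (j / 2 ^ n)‖ₑ ^ p :=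
    fun j => ((hmeas _).sub (hmeas _)).enorm.pow_const p
  have hterm : ∀ j ∈ Finset.range (2 ^ n),
      ∫⁻ ω, ‖S ω ((j + 1) / 2 ^ n) - S ω (j / 2 ^ n)‖ₑ ^ p ∂P ≤ K * (2 : ℝ≥0∞) ^ (-(n * q)) := by
    intro j hj
    have hj' : (j : ℝ) + 1 ≤ 2 ^ n := by exact_mod_cast Finset.mem_range.1 hj
    have hpos : (0 : ℝ) < 2 ^ n := by positivity
    refine (hinc _ ⟨by positivity, (div_le_one hpos).2 hj'⟩ _
      ⟨by positivity, (div_le_one hpos).2 (by linarith)⟩).trans (le_of_eq ?_)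
    congr 1
    rw [← sub_div, add_sub_cancel_left, abs_of_pos (by positivity), one_div,
      ENNReal.ofReal_inv_of_pos hpos, ENNReal.ofReal_pow (by norm_num), ENNReal.ofReal_ofNat,
      ENNReal.inv_rpow, ENNReal.rpow_neg, ENNReal.rpow_mul, ENNReal.rpow_natCast]
  have hint : ∫⁻ ω, dyadicIncrement p (S ω) n ^ p ∂P ≤ 2 ^ n * (K * (2 : ℝ≥0∞) ^ (-(n * q))) := by
    simp only [dyadicIncrement, ← ENNReal.rpow_mul, one_div_mul_cancel hp.ne', ENNReal.rpow_one]
    rw [lintegral_finsetSum _ fun j _ => hm j]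
    refine (Finset.sum_le_sum hterm).trans ?_
    simp
  refine (ENNReal.rpow_le_rpow hint (by positivity)).trans (le_of_eq ?_)
  rw [mul_left_comm, ENNReal.mul_rpow_of_nonneg _ _ (by positivity)]
  congr 1
  rw [← ENNReal.rpow_natCast, ← ENNReal.rpow_natCast, ← ENNReal.rpow_add _ _ h2 h2',
    ← ENNReal.rpow_mul, ← ENNReal.rpow_mul]
  congr 1
  ring

/-- Kolmogorov's criterion in quantitative form: the supremum of a continuous random function on
`(0, 1)` vanishing at `0` is controlled by the moments of its increments. -/
lemma exists_sup_bound_of_increments {S : Ω → ℝ → ℝ} (hmeas : ∀ x, Measurable fun ω => S ω x)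
    (hcont : ∀ ω, Continuous (S ω)) (h0 : ∀ ω, S ω 0 = 0) {p q : ℝ} (hp : 1 ≤ p) {K : ℝ≥0∞}
    (hinc : ∀ x ∈ Icc (0 : ℝ) 1, ∀ y ∈ Icc (0 : ℝ) 1,
      ∫⁻ ω, ‖S ω x - S ω y‖ₑ ^ p ∂P ≤ K * ENNReal.ofReal |x - y| ^ q) :
    ∃ N : Ω → ℝ≥0∞, Measurable N ∧ (∀ ω, ∀ x ∈ Ioo (0 : ℝ) 1, ‖S ω x‖ₑ ≤ N ω ^ (1 / p)) ∧
      (∫⁻ ω, N ω ∂P) ^ (1 / p) ≤ K ^ (1 / p) * chainingConst p q := by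
  have hp0 : 0 < p := by linarith
  have hm : ∀ n, Measurable fun ω => dyadicIncrement p (S ω) n := by
    intro n
    unfold dyadicIncrement
    refine Measurable.pow_const (Finset.measurable_fun_sum _ fun j _ => ?_) _
    exact ((hmeas _).sub (hmeas _)).enorm.pow_const p
  refine ⟨fun ω => (∑' n, dyadicIncrement p (S ω) (n + 1)) ^ p,
    (Measurable.tsum fun n => hm (n + 1)).pow_const p, fun ω x hx => ?_, ?_⟩
  · rw [← ENNReal.rpow_mul, mul_one_div_cancel hp0.ne', ENNReal.rpow_one]
    exact enorm_le_tsum_dyadicIncrement hp0 (hcont ω) (h0 ω) hx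
  · refine (lintegral_tsum_rpow_le (fun n => hm (n + 1)) hp).trans ?_
    rw [chainingConst, ← ENNReal.tsum_mul_left]
    exact ENNReal.tsum_le_tsum fun n => lintegral_dyadicIncrement_rpow_le hmeas hp0 hinc (n + 1)

end Chaining

/-! ### Moments of the supremum norm under mean-square limits -/

/-- Lower semicontinuity of the supremum norm on `L²(0, 1)`, in terms of majorants. -/
lemma eLpNorm_top_rpow_le_liminf {f : ℕ → U} {g : U} (hfg : Tendsto f atTop (𝓝 g)) {p : ℝ}
    (hp : 0 < p) {N : ℕ → ℝ≥0∞} (hN : ∀ n, eLpNorm (f n) ∞ volD ^ p ≤ N n) :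
    eLpNorm g ∞ volD ^ p ≤ liminf N atTop := by
  refine le_of_forall_gt_imp_ge_of_dense fun c hc => ?_
  -- Along a subsequence the norms stay below `c`, and a further one converges almost everywhere.
  obtain ⟨φ, hφ, hc'⟩ := extraction_of_frequently_atTop
    (frequently_lt_of_liminf_lt (by isBoundedDefault) hc)
  obtain ⟨ψ, hψ, hae⟩ := (tendstoInMeasure_of_tendsto_Lp
    (hfg.comp hφ.tendsto_atTop)).exists_seq_tendsto_ae
  have hbound : ∀ n, eLpNorm (f n) ∞ volD ≤ N n ^ (1 / p) := fun n => by
    have h := ENNReal.rpow_le_rpow (hN n) (by positivity : 0 ≤ 1 / p)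
    rwa [← ENNReal.rpow_mul, mul_one_div_cancel hp.ne', ENNReal.rpow_one] at h
  have hg : eLpNorm g ∞ volD ≤ c ^ (1 / p) := by
    refine Lp.eLpNorm_le_of_ae_tendsto (u := atTop) (f := fun i => f (φ (ψ i)))
      (Eventually.of_forall fun i => ?_) (fun i => (Lp.memLp _).1) hae
    exact (hbound _).trans (ENNReal.rpow_le_rpow (hc' _).le (by positivity))
  have h := ENNReal.rpow_le_rpow hg hp.le
  rwa [← ENNReal.rpow_mul, one_div_mul_cancel hp.ne', ENNReal.rpow_one] at h

section Limits

variable {Ω : Type*} [MeasurableSpace Ω] {P : Measure Ω}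

/-- The `p`-th moment of `‖O‖_∞` is at most `K`. As `ω ↦ ‖O ω‖_∞` is not known to be measurable,
this is witnessed by a measurable majorant of its `p`-th power. -/
def SupMomentLE (P : Measure Ω) (p : ℝ) (K : ℝ≥0∞) (O : Ω → U) : Prop :=
  ∃ N : Ω → ℝ≥0∞, Measurable N ∧ (∀ᵐ ω ∂P, eLpNorm (O ω) ∞ volD ^ p ≤ N ω) ∧ ∫⁻ ω, N ω ∂P ≤ K

lemma SupMomentLE.lintegral_le {p : ℝ} {K : ℝ≥0∞} {O : Ω → U} (h : SupMomentLE P p K O) :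
    ∫⁻ ω, eLpNorm (O ω) ∞ volD ^ p ∂P ≤ K := by
  obtain ⟨N, -, hN, hK⟩ := h
  exact (lintegral_mono_ae hN).trans hK

/-- Fatou's lemma along an almost surely convergent subsequence. -/
lemma SupMomentLE.of_tendsto {p : ℝ} (hp : 0 < p) {K : ℝ≥0∞} {O : Ω → U} {F : ℕ → Ω → U}
    (hO : AEStronglyMeasurable O P) (hF : ∀ n, AEStronglyMeasurable (F n) P)
    (hlim : Tendsto (fun n => eLpNorm (fun ω => O ω - F n ω) 2 P) atTop (𝓝 0))
    (h : ∀ n, SupMomentLE P p K (F n)) : SupMomentLE P p K O := by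
  choose N hNm hN hK using h
  have hlim' : Tendsto (fun n => eLpNorm (F n - O) 2 P) atTop (𝓝 0) := by
    refine hlim.congr fun n => ?_
    rw [eLpNorm_sub_comm]
    rfl
  obtain ⟨ns, -, hns⟩ :=
    (tendstoInMeasure_of_tendsto_eLpNorm (by norm_num) hF hO hlim').exists_seq_tendsto_ae
  refine ⟨fun ω => liminf (fun i => N (ns i) ω) atTop, Measurable.liminf fun i => hNm _, ?_, ?_⟩
  · filter_upwards [hns, ae_all_iff.2 hN] with ω h1 h2
    exact eLpNorm_top_rpow_le_liminf h1 hp fun i => h2 _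
  · refine (lintegral_liminf_le fun i => hNm _).trans ?_
    refine liminf_le_of_le (by isBoundedDefault) fun b hb => ?_
    obtain ⟨i, hi⟩ := hb.exists
    exact hi.trans (hK _)

end Limits

/-! ### The eigenbasis -/

lemma integral_cos_int_mul_pi {n : ℤ} (hn : n ≠ 0) :
    ∫ x in (0 : ℝ)..1, Real.cos (n * Real.pi * x) = 0 := by
  have hc : (n : ℝ) * Real.pi ≠ 0 := mul_ne_zero (Int.cast_ne_zero.2 hn) Real.pi_ne_zero
  rw [intervalIntegral.integral_comp_mul_left (fun x => Real.cos x) hc, integral_cos]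
  simp [Real.sin_int_mul_pi]

lemma coeFn_eigenfun (k : ℕ) :
    eigenfun k =ᵐ[volD] fun x => Real.sqrt 2 * Real.sin ((k + 1) * Real.pi * x) :=
  (memLp_sine k).coeFn_toLp

lemma inner_eigenfun (j k : ℕ) : inner ℝ (eigenfun j) (eigenfun k) = if j = k then 1 else 0 := by
  rw [L2.inner_def]
  have e1 : ∫ x, inner ℝ (eigenfun j x) (eigenfun k x) ∂volD =
      ∫ x in (0 : ℝ)..1, (Real.cos (((j : ℤ) - k : ℤ) * Real.pi * x) -
        Real.cos (((j : ℤ) + k + 2 : ℤ) * Real.pi * x)) := by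
    rw [intervalIntegral.integral_of_le zero_le_one, ← integral_Ioc_eq_integral_Ioo.symm]
    refine integral_congr_ae ?_
    filter_upwards [coeFn_eigenfun j, coeFn_eigenfun k] with x hj hk
    rw [hj, hk, Real.cos_sub_cos]
    push_cast
    rw [show ((j - k : ℝ) * Real.pi * x + (j + k + 2) * Real.pi * x) / 2 = (j + 1) * Real.pi * x by
        ring, show ((j - k : ℝ) * Real.pi * x - (j + k + 2) * Real.pi * x) / 2 =
        -((k + 1) * Real.pi * x) by ring, Real.sin_neg]
    simp only [RCLike.inner_apply, conj_trivial]
    have h2 : Real.sqrt 2 * Real.sqrt 2 = 2 := Real.mul_self_sqrt (by norm_num)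
    linear_combination
      Real.sin ((j + 1) * Real.pi * x) * Real.sin ((k + 1) * Real.pi * x) * h2
  have i1 : ∀ n : ℤ, IntervalIntegrable (fun x => Real.cos (n * Real.pi * x)) volume 0 1 :=
    fun n => Continuous.intervalIntegrable (by fun_prop) 0 1
  rw [e1, intervalIntegral.integral_sub (i1 _) (i1 _),
    integral_cos_int_mul_pi (n := (j : ℤ) + k + 2) (by omega), sub_zero]
  split_ifs with h
  · simp [h]
  · exact integral_cos_int_mul_pi (by omega)

lemma norm_eigenfun (k : ℕ) : ‖eigenfun k‖ = 1 := by
  rw [← sq_eq_sq₀ (norm_nonneg _) zero_le_one, ← real_inner_self_eq_norm_sq, inner_eigenfun]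
  simp

lemma shiftedSemigroup_eigenfun (η r : ℝ) (k : ℕ) :
    shiftedSemigroup η r (eigenfun k) = Real.exp (-(r * (eigenval k + η))) • eigenfun k := by
  unfold shiftedSemigroup
  rw [tsum_eq_single k fun j hj => by rw [inner_eigenfun, if_neg hj, mul_zero, zero_smul],
    inner_eigenfun, if_pos rfl, mul_one]

lemma eigenval_pos (k : ℕ) : 0 < eigenval k := by
  unfold eigenval
  have := Real.pi_pos
  positivity

/-! ### Step approximations of the exponential -/

lemma StepFun.eval_of_mem {t : ℝ} {V : Type*} [AddCommGroup V] (f : StepFun t V) {i : ℕ}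
    (hi : i < f.size) {s : ℝ} (hs : s ∈ Ioc (f.node i) (f.node (i + 1))) :
    f.eval s = f.value i := by
  unfold StepFun.eval
  rw [Finset.sum_eq_single i, indicator_of_mem hs]
  · intro j _ hj
    refine indicator_of_notMem (fun hs' => ?_) _
    exact (f.node_mono.pairwise_disjoint_on_Ioc_succ hj).le_bot ⟨hs', hs⟩
  · intro h
    exact absurd (Finset.mem_range.2 hi) h

/-- The step function `s ↦ f(s) v` for a real step function `f` and a vector `v`. -/
def StepFun.smulVec {t : ℝ} {V : Type*} [AddCommGroup V] [Module ℝ V] (f : StepFun t ℝ) (v : V) :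
    StepFun t V :=
  { f with value := fun i => f.value i • v }

lemma StepFun.eval_smulVec {t : ℝ} {V : Type*} [AddCommGroup V] [Module ℝ V] (f : StepFun t ℝ)
    (v : V) (s : ℝ) : (f.smulVec v).eval s = f.eval s • v := by
  unfold StepFun.eval StepFun.smulVec
  rw [Finset.sum_smul]
  refine Finset.sum_congr rfl fun i _ => ?_
  by_cases hs : s ∈ Ioc (f.node i) (f.node (i + 1)) <;> simp [hs]

lemma StepFun.integral_smulVec {t : ℝ} {V : Type*} [AddCommGroup V] [Module ℝ V]
    (f : StepFun t ℝ) (v : V) {Ω : Type*} (w : ℝ → Ω → ℝ) (ω : Ω) :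
    (f.smulVec v).integral w ω = f.integral w ω • v := by
  unfold StepFun.integral StepFun.smulVec
  rw [Finset.sum_smul]
  exact Finset.sum_congr rfl fun i _ => by rw [smul_smul, smul_eq_mul]

/-- The approximation of `s ↦ exp(-μ (t - s))` on a uniform grid with `n + 1` cells that takes the
value at the left endpoint of each cell. As the exponential increases, it lies below it. -/
noncomputable def expStep {t : ℝ} (ht : 0 ≤ t) (μ : ℝ) (n : ℕ) : StepFun t ℝ where
  size := n + 1
  node i := min (t * (i / (n + 1))) t
  node_mono := by
    intro i j hij
    have : (i : ℝ) ≤ j := by exact_mod_cast hij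
    dsimp only
    gcongr
  node_mem i := ⟨le_min (by positivity) ht, min_le_right _ _⟩
  value i := Real.exp (-(μ * (t - min (t * (i / (n + 1))) t)))

lemma exists_expStep_eval_eq {t : ℝ} (ht : 0 ≤ t) (μ : ℝ) (n : ℕ) {s : ℝ} (hs : s ∈ Ioc 0 t) :
    ∃ x, x ≤ s ∧ s ≤ x + t / (n + 1) ∧
      (expStep ht μ n).eval s = Real.exp (-(μ * (t - x))) := by
  have ht0 : 0 < t := hs.1.trans_le hs.2
  have hn : (0 : ℝ) < n + 1 := by positivity
  -- `s` lies in the cell with index `⌈u⌉ - 1`, as the cells are open on the left.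
  set u : ℝ := s / t * (n + 1) with hu
  have hu0 : 0 < u := by have := hs.1; positivity
  have hun : u ≤ n + 1 := mul_le_of_le_one_left hn.le ((div_le_one ht0).2 hs.2)
  obtain ⟨i, hi⟩ : ∃ i, ⌈u⌉₊ = i + 1 := Nat.exists_eq_succ_of_ne_zero (Nat.ceil_pos.2 hu0).ne'
  have h1 : u ≤ i + 1 := by
    have := Nat.le_ceil u
    rw [hi] at this
    exact_mod_cast this
  have h2 : (i : ℝ) < u := by
    have : i < ⌈u⌉₊ := by omega
    exact Nat.lt_ceil.1 this
  have hin : i < n + 1 := by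
    have : (i : ℝ) < n + 1 := h2.trans_le hun
    exact_mod_cast this
  have hsu : s = t * (u / (n + 1)) := by
    rw [hu]
    field_simp
  have h3 : t * (i / (n + 1)) < s := by
    rw [hsu]
    gcongr
  have h4 : s ≤ t * ((i + 1) / (n + 1)) := by
    rw [hsu]
    gcongr
  have h5 : min (t * (i / (n + 1) : ℝ)) t = t * (i / (n + 1)) := min_eq_left (h3.le.trans hs.2)
  refine ⟨t * (i / (n + 1)), h3.le, ?_, ?_⟩
  · refine h4.trans (le_of_eq ?_)
    field_simp
  · rw [StepFun.eval_of_mem (i := i) _ hin]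
    · simp only [expStep, h5]
    · simp only [expStep, h5, mem_Ioc]
      refine ⟨h3, le_min ?_ hs.2⟩
      push_cast
      exact h4

lemma expStep_eval_nonneg {t : ℝ} (ht : 0 ≤ t) (μ : ℝ) (n : ℕ) (s : ℝ) :
    0 ≤ (expStep ht μ n).eval s :=
  Finset.sum_nonneg fun _ _ => indicator_nonneg (fun _ _ => (Real.exp_pos _).le) _

lemma expStep_eval_le {t : ℝ} (ht : 0 ≤ t) {μ : ℝ} (hμ : 0 ≤ μ) (n : ℕ) {s : ℝ}
    (hs : s ∈ Ioc 0 t) : (expStep ht μ n).eval s ≤ Real.exp (-(μ * (t - s))) := by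
  obtain ⟨x, hx, -, he⟩ := exists_expStep_eval_eq ht μ n hs
  rw [he]
  gcongr

lemma exp_sub_expStep_eval_le {t : ℝ} (ht : 0 ≤ t) {μ : ℝ} (hμ : 0 ≤ μ) (n : ℕ) {s : ℝ}
    (hs : s ∈ Ioc 0 t) :
    ‖Real.exp (-(μ * (t - s))) - (expStep ht μ n).eval s‖ ≤ μ * t / (n + 1) := by
  rw [Real.norm_of_nonneg (sub_nonneg.2 (expStep_eval_le ht hμ n hs))]
  obtain ⟨x, hx, hx2, he⟩ := exists_expStep_eval_eq ht μ n hs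
  rw [he]
  have h1 : Real.exp (-(μ * (t - s))) * (1 - μ * (s - x)) ≤ Real.exp (-(μ * (t - x))) := by
    have : -(μ * (t - x)) = -(μ * (t - s)) + -(μ * (s - x)) := by ring
    rw [this, Real.exp_add]
    gcongr
    linarith [Real.add_one_le_exp (-(μ * (s - x)))]
  have h2 : Real.exp (-(μ * (t - s))) ≤ 1 :=
    Real.exp_le_one_iff.2 (neg_nonpos.2 (mul_nonneg hμ (by linarith [hs.2])))
  have h3 : 0 ≤ μ * (s - x) := mul_nonneg hμ (by linarith)
  have h4 : μ * (s - x) ≤ μ * (t / (n + 1)) := by gcongr; linarith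
  rw [mul_div_assoc]
  nlinarith

lemma tendsto_eLpNorm_exp_sub_expStep {t : ℝ} (ht : 0 ≤ t) {μ : ℝ} (hμ : 0 ≤ μ) {V : Type*}
    [NormedAddCommGroup V] [NormedSpace ℝ V] (v : V) :
    Tendsto (fun n => eLpNorm (fun s => Real.exp (-((t - s) * μ)) • v -
      ((expStep ht μ n).smulVec v).eval s) 2 (volume.restrict (Ioc 0 t))) atTop (𝓝 0) := by
  have hb : ∀ n : ℕ, eLpNorm (fun s => Real.exp (-((t - s) * μ)) • v -
      ((expStep ht μ n).smulVec v).eval s) 2 (volume.restrict (Ioc 0 t)) ≤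
      ENNReal.ofReal t ^ (1 / 2 : ℝ) * ENNReal.ofReal (μ * t * ‖v‖ / (n + 1)) := by
    intro n
    have h := eLpNorm_le_of_ae_bound (p := 2) (μ := volume.restrict (Ioc 0 t))
      (f := fun s => Real.exp (-((t - s) * μ)) • v - ((expStep ht μ n).smulVec v).eval s)
      (C := μ * t * ‖v‖ / (n + 1)) ?_
    · simpa using h
    · filter_upwards [ae_restrict_mem measurableSet_Ioc] with s hs
      rw [StepFun.eval_smulVec, ← sub_smul, norm_smul, mul_comm (t - s)]
      refine (mul_le_mul_of_nonneg_right (exp_sub_expStep_eval_le ht hμ n hs)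
        (norm_nonneg v)).trans (le_of_eq (by ring))
  have hlim : Tendsto (fun n : ℕ => ENNReal.ofReal t ^ (1 / 2 : ℝ) *
      ENNReal.ofReal (μ * t * ‖v‖ / (n + 1))) atTop (𝓝 0) := by
    have h1 : Tendsto (fun n : ℕ => μ * t * ‖v‖ / ((n : ℝ) + 1)) atTop (𝓝 0) :=
      tendsto_const_nhds.div_atTop (tendsto_natCast_atTop_atTop.atTop_add tendsto_const_nhds)
    have h2 := ENNReal.Tendsto.const_mul (ENNReal.tendsto_ofReal h1)
      (Or.inr (ENNReal.rpow_ne_top_of_nonneg (by norm_num : (0 : ℝ) ≤ 1 / 2)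
        (ENNReal.ofReal_ne_top (r := t))))
    rwa [ENNReal.ofReal_zero, mul_zero] at h2
  exact tendsto_of_tendsto_of_tendsto_of_le_of_le tendsto_const_nhds hlim (fun _ => bot_le) hb

section

variable {Ω : Type*} [MeasurableSpace Ω] {P : Measure Ω} [IsProbabilityMeasure P] {H T t : ℝ}

/-- As the step functions lie below the exponential and the kernel is nonnegative, the variance of
their integrals is at most the double integral for the exponential itself. -/
lemma IsFBm.lintegral_expStep_integral_le {w : ℝ → Ω → ℝ} (hw : IsFBm H T w P) (hH : 1 / 2 < H)
    (ht : 0 ≤ t) (htT : t ≤ T) {μ : ℝ} (hμ : 0 < μ) (n : ℕ) :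
    ∫⁻ ω, ‖(expStep ht μ n).integral w ω‖ₑ ^ 2 ∂P ≤
      ENNReal.ofReal (expVarConst H / μ ^ (2 * H)) := by
  refine (hw.lintegral_stepFun_integral_le hH htT _).trans
    (le_trans ?_ (lintegral_fbmMeasure_exp_le hH hμ ht))
  have hm : Measurable (expStep ht μ n).eval := (stronglyMeasurable_stepFun_eval _).measurable
  have hb : ∀ s ∈ Ioc 0 t, ‖(expStep ht μ n).eval s‖ₑ ≤
      ENNReal.ofReal (Real.exp (-(μ * (t - s)))) := fun s hs => by
    rw [Real.enorm_of_nonneg (expStep_eval_nonneg ht μ n s)]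
    exact ENNReal.ofReal_le_ofReal (expStep_eval_le ht hμ.le n hs)
  rw [lintegral_fbmMeasure H t (by fun_prop), lintegral_fbmMeasure H t (by fun_prop)]
  refine setLIntegral_mono' measurableSet_Ioc fun s hs => setLIntegral_mono' measurableSet_Ioc
    fun r hr => ?_
  dsimp only
  gcongr
  exacts [hb s hs, hb r hr]

end

/-! ### The series of variances -/

lemma sq_le_eigenval_add (k : ℕ) {η : ℝ} (hη : 0 ≤ η) : ((k : ℝ) + 1) ^ 2 ≤ eigenval k + η := by
  have h : ((k : ℝ) + 1) ≤ ((k : ℝ) + 1) * Real.pi :=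
    le_mul_of_one_le_right (by positivity) (by linarith [Real.pi_gt_three])
  have h2 : ((k : ℝ) + 1) ^ 2 ≤ eigenval k := by
    unfold eigenval
    gcongr
  linarith

lemma rpow_le_eigenval_add_rpow (k : ℕ) {η : ℝ} (hη : 0 ≤ η) {H : ℝ} (hH : 0 ≤ H) :
    ((k : ℝ) + 1) ^ (4 * H) ≤ (eigenval k + η) ^ (2 * H) := by
  have hk : (0 : ℝ) ≤ (k : ℝ) + 1 := by positivity
  have h := Real.rpow_le_rpow (by positivity) (sq_le_eigenval_add k hη)
    (by linarith : 0 ≤ 2 * H)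
  rwa [← Real.rpow_natCast, ← Real.rpow_mul hk, Nat.cast_ofNat, ← mul_assoc,
    show (2 : ℝ) * 2 = 4 by norm_num] at h

lemma summable_succ_rpow {a : ℝ} (ha : a < -1) : Summable fun k : ℕ => ((k : ℝ) + 1) ^ a := by
  have h := (summable_nat_add_iff 1).2 (Real.summable_nat_rpow.2 ha)
  simpa using h

lemma summable_rpow_div_eigenval {H β η : ℝ} (hH : 1 / 2 < H) (hβ4 : β < 1 / 4) (hη : 0 ≤ η) :
    Summable fun k : ℕ => ((k : ℝ) + 1) ^ (4 * β) / (eigenval k + η) ^ (2 * H) := by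
  refine Summable.of_nonneg_of_le (fun k => ?_) (fun k => ?_)
    (summable_succ_rpow (a := 4 * β - 4 * H) (by linarith))
  · have := eigenval_pos k
    positivity
  · rw [Real.rpow_sub (by positivity)]
    gcongr
    exact rpow_le_eigenval_add_rpow k hη (by linarith)

/-- The interpolation between `|sin a - sin b| ≤ 2` and `|sin a - sin b| ≤ |a - b|`. -/
lemma sq_sin_sub_sin_le {a b γ : ℝ} (hγ : 0 ≤ γ) (hγ2 : γ ≤ 2) :
    (Real.sin a - Real.sin b) ^ 2 ≤ 4 * |a - b| ^ γ := by
  rw [← sq_abs]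
  have h1 : |Real.sin a - Real.sin b| ≤ 2 := by
    have ha := abs_le.1 (Real.abs_sin_le_one a)
    have hb := abs_le.1 (Real.abs_sin_le_one b)
    exact abs_le.2 ⟨by linarith [ha.1, hb.2], by linarith [ha.2, hb.1]⟩
  have h2 : |Real.sin a - Real.sin b| ≤ |a - b| := by
    have := Real.lipschitzWith_sin.dist_le_mul a b
    simpa [Real.dist_eq] using this
  rcases le_total |a - b| 1 with h | h
  · have h3 : |a - b| ^ (2 : ℝ) ≤ |a - b| ^ γ := by
      rcases (abs_nonneg (a - b)).eq_or_lt with h0 | h0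
      · rw [← h0, Real.zero_rpow two_ne_zero]
        positivity
      · exact Real.rpow_le_rpow_of_exponent_ge h0 h hγ2
    rw [Real.rpow_two] at h3
    nlinarith [abs_nonneg (Real.sin a - Real.sin b), sq_nonneg |a - b|]
  · have h3 : 1 ≤ |a - b| ^ γ := Real.one_le_rpow h hγ
    nlinarith [abs_nonneg (Real.sin a - Real.sin b)]

lemma sq_eigenfun_increment_le {β : ℝ} (hβ : 0 ≤ β) (hβ4 : β ≤ 1 / 4) (k : ℕ) (x y : ℝ) :
    (Real.sqrt 2 * Real.sin ((k + 1) * Real.pi * x) -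
      Real.sqrt 2 * Real.sin ((k + 1) * Real.pi * y)) ^ 2 ≤
      8 * Real.pi * |x - y| ^ (4 * β) * ((k : ℝ) + 1) ^ (4 * β) := by
  have hk : (0 : ℝ) ≤ (k : ℝ) + 1 := by positivity
  have h := sq_sin_sub_sin_le (a := (k + 1) * Real.pi * x) (b := (k + 1) * Real.pi * y)
    (γ := 4 * β) (by linarith) (by linarith)
  rw [← mul_sub, abs_mul, abs_of_nonneg (mul_nonneg hk Real.pi_pos.le),
    Real.mul_rpow (by positivity) (abs_nonneg _), Real.mul_rpow hk Real.pi_pos.le] at h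
  have hpi : Real.pi ^ (4 * β) ≤ Real.pi := by
    have := Real.rpow_le_rpow_of_exponent_le (by linarith [Real.pi_gt_three] : 1 ≤ Real.pi)
      (by linarith : 4 * β ≤ 1)
    rwa [Real.rpow_one] at this
  rw [← mul_sub, mul_pow, Real.sq_sqrt (by norm_num)]
  calc 2 * (Real.sin ((k + 1) * Real.pi * x) - Real.sin ((k + 1) * Real.pi * y)) ^ 2
      ≤ 2 * (4 * (((k : ℝ) + 1) ^ (4 * β) * Real.pi ^ (4 * β) * |x - y| ^ (4 * β))) := by gcongr
    _ ≤ 2 * (4 * (((k : ℝ) + 1) ^ (4 * β) * Real.pi * |x - y| ^ (4 * β))) := by gcongr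
    _ = _ := by ring

/-! ### The stochastic convolution -/

section StochasticConvolution

variable {Ω : Type*} [MeasurableSpace Ω] {P : Measure Ω} [IsProbabilityMeasure P] {H T t η : ℝ}
  {w : ℕ → ℝ → Ω → ℝ}

lemma tendsto_eLpNorm_semigroup_sub_expStep (ht : 0 ≤ t) (hη : 0 ≤ η) (k : ℕ) :
    Tendsto (fun n => eLpNorm (fun s => shiftedSemigroup η (t - s) (eigenfun k) -
      ((expStep ht (eigenval k + η) n).smulVec (eigenfun k)).eval s) 2
        (volume.restrict (Ioc 0 t))) atTop (𝓝 0) := by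
  simp_rw [shiftedSemigroup_eigenfun]
  exact tendsto_eLpNorm_exp_sub_expStep ht (by linarith [eigenval_pos k]) _

lemma IsFBm.eLpNorm_expStep_smulVec_integral_le {w : ℝ → Ω → ℝ} (hw : IsFBm H T w P)
    (hH : 1 / 2 < H) (ht : 0 ≤ t) (htT : t ≤ T) (hη : 0 ≤ η) (k n : ℕ) :
    eLpNorm (((expStep ht (eigenval k + η) n).smulVec (eigenfun k)).integral w) 2 P ≤
      ENNReal.ofReal (Real.sqrt (expVarConst H) * ((k : ℝ) + 1) ^ (-(2 * H))) := by
  have hμ : 0 < eigenval k + η := by linarith [eigenval_pos k]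
  have hc := (expVarConst_pos hH).le
  have hk : (0 : ℝ) ≤ (k : ℝ) + 1 := by positivity
  have h1 := hw.lintegral_expStep_integral_le hH ht htT hμ n
  rw [eLpNorm_two_eq_lintegral]
  simp_rw [StepFun.integral_smulVec, enorm_smul]
  have hn : ‖eigenfun k‖ₑ = 1 := by rw [← ofReal_norm, norm_eigenfun, ENNReal.ofReal_one]
  simp_rw [hn, mul_one]
  refine (ENNReal.rpow_le_rpow h1 (by norm_num)).trans ?_
  rw [ENNReal.ofReal_rpow_of_nonneg (by positivity) (by norm_num)]
  refine ENNReal.ofReal_le_ofReal ?_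
  rw [Real.div_rpow hc (by positivity), ← Real.sqrt_eq_rpow, div_eq_mul_inv, ← Real.rpow_mul hμ.le]
  gcongr
  rw [Real.rpow_neg hk, show 2 * H * (1 / 2) = 2 * (H / 2) by ring,
    show 2 * H = 4 * (H / 2) by ring]
  gcongr
  exact rpow_le_eigenval_add_rpow k hη (by linarith)

lemma IsCylindricalFBm.exists_isStochasticConvolution (hw : IsCylindricalFBm H T w P)
    (hH : 1 / 2 < H) (ht : 0 ≤ t) (htT : t ≤ T) (hη : 0 ≤ η) :
    ∃ O : Ω → U, IsStochasticConvolution w η t O P := by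
  have hG : ∀ k, AEStronglyMeasurable (fun s => shiftedSemigroup η (t - s) (eigenfun k))
      (volume.restrict (Ioc 0 t)) := fun k => by
    simp_rw [shiftedSemigroup_eigenfun]
    exact Continuous.aestronglyMeasurable (by fun_prop)
  choose I hI hIW using fun k => exists_isWienerIntegral (hw.isFBm k) hH ht htT (hG k)
    (tendsto_eLpNorm_semigroup_sub_expStep ht hη k)
  have hbound : ∀ k, eLpNorm (I k) 2 P ≤
      ENNReal.ofReal (Real.sqrt (expVarConst H) * ((k : ℝ) + 1) ^ (-(2 * H))) := by
    intro k
    have hlim := (hIW k).tendsto_of_tendsto (hw.isFBm k) hH ht htT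
      (tendsto_eLpNorm_semigroup_sub_expStep ht hη k)
    have hlim2 := hlim.add_const
      (ENNReal.ofReal (Real.sqrt (expVarConst H) * ((k : ℝ) + 1) ^ (-(2 * H))))
    rw [zero_add] at hlim2
    refine ge_of_tendsto' hlim2 fun n => ?_
    have hS := ((hw.isFBm k).memLp_stepFun_integral htT
      ((expStep ht (eigenval k + η) n).smulVec (eigenfun k))).1
    have h := eLpNorm_add_le ((hI k).1.sub hS) hS (p := 2) (by norm_num)
    rw [sub_add_cancel] at h
    exact h.trans (add_le_add le_rfl
      ((hw.isFBm k).eLpNorm_expStep_smulVec_integral_le hH ht htT hη k n))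
  -- As `2 H > 1`, the series converges absolutely in `L²(Ω; U)`.
  have hsum : Summable fun k => (hI k).toLp (I k) := by
    refine Summable.of_norm_bounded
      ((summable_succ_rpow (a := -(2 * H)) (by linarith)).mul_left (Real.sqrt (expVarConst H)))
      fun k => ?_
    rw [Lp.norm_toLp]
    exact ENNReal.toReal_le_of_le_ofReal (by positivity) (hbound k)
  have hpart : ∀ n, (∑ k ∈ Finset.range n, (hI k).toLp (I k) : Lp U 2 P) =ᵐ[P]
      fun ω => ∑ k ∈ Finset.range n, I k ω := by
    intro n
    filter_upwards [Lp.coeFn_fun_finsetSum (Finset.range n) fun k => (hI k).toLp (I k),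
      ae_all_iff.2 fun k => (hI k).coeFn_toLp] with ω h1 h2
    rw [h1]
    exact Finset.sum_congr rfl fun k _ => h2 k
  refine ⟨(∑' k, (hI k).toLp (I k) : Lp U 2 P), (Lp.memLp _).1, I, hIW, ?_⟩
  have hX := tendsto_iff_edist_tendsto_0.1 hsum.hasSum.tendsto_sum_nat
  refine hX.congr fun n => ?_
  rw [edist_comm, Lp.edist_def]
  refine eLpNorm_congr_ae ?_
  filter_upwards [hpart n] with ω hω
  rw [Pi.sub_apply, hω]

/-- The bound on the `p`-th moment of the supremum norm of the stochastic convolution when the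
series on the right has sum `A`. -/
noncomputable def supMomentBound (H β p A : ℝ) : ℝ≥0∞ :=
  (gaussianMoment p * ENNReal.ofReal (8 * Real.pi * expVarConst H * A) ^ (p / 2)) ^ (1 / p) *
    chainingConst p (2 * β * p)

/-- The moment bound for partial sums of the series whose integrands are step functions. In this
case the coefficients are Gaussian and independent by construction. -/
lemma IsCylindricalFBm.supMomentLE_expStep_sum (hw : IsCylindricalFBm H T w P)
    (hH : 1 / 2 < H) (ht : 0 ≤ t) (htT : t ≤ T) (hη : 0 ≤ η) {β p : ℝ} (hβ : 0 < β)
    (hβ4 : β < 1 / 4) (hp : 1 ≤ p) (n m : ℕ) :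
    SupMomentLE P p (supMomentBound H β p
        (∑' k : ℕ, ((k : ℝ) + 1) ^ (4 * β) / (eigenval k + η) ^ (2 * H)) ^ p)
      (fun ω => ∑ k ∈ Finset.range n,
        ((expStep ht (eigenval k + η) m).smulVec (eigenfun k)).integral (w k) ω) := by
  set Z : ℕ → Ω → ℝ := fun k => (expStep ht (eigenval k + η) m).integral (w k) with hZ
  set e : ℕ → ℝ → ℝ := fun k x => Real.sqrt 2 * Real.sin ((k + 1) * Real.pi * x) with he
  set S : Ω → ℝ → ℝ := fun ω x => ∑ k ∈ Finset.range n, Z k ω * e k x with hS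
  set A : ℝ := ∑' k : ℕ, ((k : ℝ) + 1) ^ (4 * β) / (eigenval k + η) ^ (2 * H) with hA
  have hp0 : 0 < p := by linarith
  have hμ : ∀ k, 0 < eigenval k + η := fun k => by linarith [eigenval_pos k]
  have hC := (expVarConst_pos hH).le
  have hterm : ∀ k : ℕ, 0 ≤ ((k : ℝ) + 1) ^ (4 * β) / (eigenval k + η) ^ (2 * H) := fun k => by
    have := hμ k
    positivity
  have hA0 : 0 ≤ A := tsum_nonneg hterm
  have hZm : ∀ k, Measurable (Z k) := fun k => by
    refine Finset.measurable_fun_sum _ fun i _ => Measurable.smul_const (Measurable.sub ?_ ?_) _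
    · exact (hw.isFBm k).measurable _ ⟨(StepFun.node_mem _ _).1, (StepFun.node_mem _ _).2.trans htT⟩
    · exact (hw.isFBm k).measurable _ ⟨(StepFun.node_mem _ _).1, (StepFun.node_mem _ _).2.trans htT⟩
  have hvar : ∀ x y : ℝ, ∑ k ∈ Finset.range n,
      expVarConst H / (eigenval k + η) ^ (2 * H) * (e k x - e k y) ^ 2 ≤
      8 * Real.pi * expVarConst H * A * |x - y| ^ (4 * β) := by
    intro x y
    calc ∑ k ∈ Finset.range n, expVarConst H / (eigenval k + η) ^ (2 * H) * (e k x - e k y) ^ 2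
        ≤ ∑ k ∈ Finset.range n, 8 * Real.pi * expVarConst H * |x - y| ^ (4 * β) *
          (((k : ℝ) + 1) ^ (4 * β) / (eigenval k + η) ^ (2 * H)) := by
          refine Finset.sum_le_sum fun k _ => ?_
          have := hμ k
          refine (mul_le_mul_of_nonneg_left (sq_eigenfun_increment_le hβ.le hβ4.le k x y)
            (by positivity)).trans (le_of_eq ?_)
          ring
      _ ≤ 8 * Real.pi * expVarConst H * |x - y| ^ (4 * β) * A := by
          rw [← Finset.mul_sum]
          gcongr
          exact (summable_rpow_div_eigenval hH hβ4 hη).sum_le_tsum _ fun k _ => hterm k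
      _ = _ := by ring
  have hinc : ∀ x ∈ Icc (0 : ℝ) 1, ∀ y ∈ Icc (0 : ℝ) 1, ∫⁻ ω, ‖S ω x - S ω y‖ₑ ^ p ∂P ≤
      gaussianMoment p * ENNReal.ofReal (8 * Real.pi * expVarConst H * A) ^ (p / 2) *
        ENNReal.ofReal |x - y| ^ (2 * β * p) := by
    intro x _ y _
    have h := hw.lintegral_enorm_sum_rpow_le htT (fun k => expStep ht (eigenval k + η) m)
      (v := fun k => expVarConst H / (eigenval k + η) ^ (2 * H))
      (fun k => by have := hμ k; positivity)
      (fun k => (hw.isFBm k).lintegral_expStep_integral_le hH ht htT (hμ k) m)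
      (fun k => e k x - e k y) n hp0.le
    have hdiff : ∀ ω, S ω x - S ω y = ∑ k ∈ Finset.range n, Z k ω * (e k x - e k y) := fun ω => by
      simp only [hS, mul_sub, Finset.sum_sub_distrib]
    simp_rw [hdiff]
    refine h.trans ?_
    rw [mul_assoc]
    gcongr
    refine (ENNReal.rpow_le_rpow (ENNReal.ofReal_le_ofReal (hvar x y)) (by positivity)).trans
      (le_of_eq ?_)
    rw [ENNReal.ofReal_mul (by positivity), ENNReal.mul_rpow_of_nonneg _ _ (by positivity),
      ← ENNReal.ofReal_rpow_of_nonneg (abs_nonneg _) (by positivity), ← ENNReal.rpow_mul]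
    congr 2
    ring
  obtain ⟨N, hN, hSN, hK⟩ := exists_sup_bound_of_increments (S := S)
    (fun x => by simp only [hS]; fun_prop) (fun ω => by simp only [hS, he]; fun_prop)
    (fun ω => by simp [hS, he]) hp hinc
  refine ⟨N, hN, Eventually.of_forall fun ω => ?_, ?_⟩
  · have hcoe : (∑ k ∈ Finset.range n, Z k ω • eigenfun k : U) =ᵐ[volD] S ω := by
      filter_upwards [Lp.coeFn_fun_finsetSum (Finset.range n) fun k => Z k ω • eigenfun k,
        ae_all_iff.2 coeFn_eigenfun, ae_all_iff.2 fun k => Lp.coeFn_smul (Z k ω) (eigenfun k)]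
        with x h1 h2 h3
      rw [h1]
      refine Finset.sum_congr rfl fun k _ => ?_
      rw [h3, Pi.smul_apply, h2, smul_eq_mul]
    simp_rw [StepFun.integral_smulVec]
    rw [eLpNorm_congr_ae hcoe]
    have hb : eLpNorm (S ω) ∞ volD ≤ N ω ^ (1 / p) := by
      rw [eLpNorm_exponent_top]
      refine eLpNormEssSup_le_of_ae_enorm_bound ?_
      filter_upwards [ae_restrict_mem measurableSet_Ioo] with x hx
      exact hSN ω x hx
    have h := ENNReal.rpow_le_rpow hb hp0.le
    rwa [← ENNReal.rpow_mul, one_div_mul_cancel hp0.ne', ENNReal.rpow_one] at h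
  · have h := ENNReal.rpow_le_rpow hK hp0.le
    rwa [← ENNReal.rpow_mul, one_div_mul_cancel hp0.ne', ENNReal.rpow_one] at h

lemma IsCylindricalFBm.supMomentLE_stochasticConvolution (hw : IsCylindricalFBm H T w P)
    (hH : 1 / 2 < H) (ht : 0 ≤ t) (htT : t ≤ T) (hη : 0 ≤ η) {β p : ℝ} (hβ : 0 < β)
    (hβ4 : β < 1 / 4) (hp : 1 ≤ p) {O : Ω → U} (hO : IsStochasticConvolution w η t O P) :
    SupMomentLE P p (supMomentBound H β p
        (∑' k : ℕ, ((k : ℝ) + 1) ^ (4 * β) / (eigenval k + η) ^ (2 * H)) ^ p) O := by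
  obtain ⟨hOm, I, hI, hlim⟩ := hO
  have hp0 : 0 < p := by linarith
  have hIm : ∀ k, AEStronglyMeasurable (I k) P := fun k => (hI k).2.1
  have hSm : ∀ k m, AEStronglyMeasurable
      (((expStep ht (eigenval k + η) m).smulVec (eigenfun k)).integral (w k)) P :=
    fun k m => ((hw.isFBm k).memLp_stepFun_integral htT _).1
  refine SupMomentLE.of_tendsto hp0 hOm
    (fun n => Finset.aestronglyMeasurable_fun_sum _ fun k _ => hIm k) hlim fun n => ?_
  refine SupMomentLE.of_tendsto hp0 (Finset.aestronglyMeasurable_fun_sum _ fun k _ => hIm k)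
    (fun m => Finset.aestronglyMeasurable_fun_sum _ fun k _ => hSm k m) ?_
    fun m => hw.supMomentLE_expStep_sum hH ht htT hη hβ hβ4 hp n m
  have hlim2 := tendsto_finsetSum (Finset.range n) fun k _ =>
    (hI k).tendsto_of_tendsto (hw.isFBm k) hH ht htT
      (tendsto_eLpNorm_semigroup_sub_expStep ht hη k)
  rw [Finset.sum_const_zero] at hlim2
  refine tendsto_of_tendsto_of_tendsto_of_le_of_le tendsto_const_nhds hlim2 (fun _ => bot_le)
    fun m => ?_
  have h := eLpNorm_sum_le (p := 2) (s := Finset.range n)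
    (f := fun k ω =>
      I k ω - ((expStep ht (eigenval k + η) m).smulVec (eigenfun k)).integral (w k) ω)
    (fun k _ => (hIm k).sub (hSm k m)) (by norm_num)
  refine le_trans (le_of_eq ?_) h
  congr 1
  ext1 ω
  simp [Finset.sum_sub_distrib]

end StochasticConvolution

lemma supMomentBound_eq {H β p : ℝ} (hH : 1 / 2 < H) (hp : 0 < p) (A : ℝ) :
    supMomentBound H β p A = gaussianMoment p ^ (1 / p) * chainingConst p (2 * β * p) *
      ENNReal.ofReal (8 * Real.pi * expVarConst H) ^ (1 / 2 : ℝ) *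
        ENNReal.ofReal A ^ (1 / 2 : ℝ) := by
  have hC := (expVarConst_pos hH).le
  have hpi := Real.pi_pos
  rw [supMomentBound, ENNReal.mul_rpow_of_nonneg _ _ (by positivity), ← ENNReal.rpow_mul,
    ENNReal.ofReal_mul (by positivity), ENNReal.mul_rpow_of_nonneg _ _ (by positivity),
    show p / 2 * (1 / p) = 1 / 2 by field_simp]
  ring

theorem mainTheorem5 (H β p : ℝ) (hH : 1 / 2 < H) (hH1 : H < 1) (hβ : 0 < β) (hβ4 : β < 1 / 4)
    (hp : 1 / β < p) :
    ∃ C : ℝ, 0 < C ∧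
      ∀ (η : ℝ), 0 ≤ η →
        Summable (fun k : ℕ => ((k : ℝ) + 1) ^ (4 * β) / (eigenval k + η) ^ (2 * H)) ∧
        ∀ (Ω : Type*) [MeasurableSpace Ω] (P : Measure Ω) [IsProbabilityMeasure P]
          (T : ℝ) (w : ℕ → ℝ → Ω → ℝ), 0 < T → IsCylindricalFBm H T w P →
          ∀ t ∈ Icc (0 : ℝ) T,
            (∃ O : Ω → U, IsStochasticConvolution w η t O P) ∧
            ∀ O : Ω → U, IsStochasticConvolution w η t O P →
              (∫⁻ ω, eLpNorm (O ω) ∞ volD ^ p ∂P) ^ (1 / p) ≤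
                ENNReal.ofReal (C * (∑' k : ℕ,
                  ((k : ℝ) + 1) ^ (4 * β) / (eigenval k + η) ^ (2 * H)) ^ (1 / 2 : ℝ)) := by
  have hβp : 1 < β * p := by rwa [div_lt_iff₀' hβ] at hp
  have hp1 : 1 ≤ p := by nlinarith
  have hp0 : 0 < p := by linarith
  set C : ℝ≥0∞ := gaussianMoment p ^ (1 / p) * chainingConst p (2 * β * p) *
    ENNReal.ofReal (8 * Real.pi * expVarConst H) ^ (1 / 2 : ℝ) with hC
  have hCtop : C ≠ ∞ :=
    ENNReal.mul_ne_top (ENNReal.mul_ne_top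
      (ENNReal.rpow_ne_top_of_nonneg (by positivity) (gaussianMoment_ne_top hp0))
      (chainingConst_ne_top hp0 (by nlinarith)))
      (ENNReal.rpow_ne_top_of_nonneg (by norm_num) ENNReal.ofReal_ne_top)
  -- The `1` is added only to make the constant positive.
  refine ⟨C.toReal + 1, by positivity, fun η hη =>
    ⟨summable_rpow_div_eigenval hH hβ4 hη, fun Ω _ P _ T w _ hw t ht =>
      ⟨hw.exists_isStochasticConvolution hH ht.1 ht.2 hη, fun O hO => ?_⟩⟩⟩
  have h := ENNReal.rpow_le_rpow
    (hw.supMomentLE_stochasticConvolution hH ht.1 ht.2 hη hβ hβ4 hp1 hO).lintegral_le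
    (by positivity : 0 ≤ 1 / p)
  rw [← ENNReal.rpow_mul, mul_one_div_cancel hp0.ne', ENNReal.rpow_one,
    supMomentBound_eq hH hp0] at h
  refine h.trans ?_
  have hA : 0 ≤ ∑' k : ℕ, ((k : ℝ) + 1) ^ (4 * β) / (eigenval k + η) ^ (2 * H) :=
    tsum_nonneg fun k => by
      have := eigenval_pos k
      positivity
  rw [← hC, ENNReal.ofReal_mul (by positivity), ← ENNReal.ofReal_rpow_of_nonneg hA (by norm_num)]
  gcongr
  rw [← ENNReal.ofReal_toReal hCtop]
  exact ENNReal.ofReal_le_ofReal (by rw [ENNReal.toReal_ofReal ENNReal.toReal_nonneg]; linarith)
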